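/- A length function on a group $G$ is a map $l:G\to[0,\infty)$ with $l(e)=0$, $l(g^{-1})=l(g)$ and $l(gh)\le l(g)+l(h)$. For $f:\mathbb N\to\mathbb R$ we say that $(G,l)$ has $f$-decay if $\|x\|\le f(n)\,\|x\|_2$ for every $n\in\mathbb N$ and every $x\in\mathbb C[G]$ supported on $\{g: l(g)\le n\}$, where $\|x\|$ is the norm of $x$ acting on $\ell^2(G)$ through the left regular representation and $\|x\|_2=(\sum_g|x(g)|^2)^{1/2}$. $(G,l)$ has RD if it has $f$-decay for some polynomial $f$, and SD if it has $f$-decay for some $f:\mathbb N\to[0,\infty)$ with $\lim_n f(n)^{1/n}=1$. Let $G$ and $H$ be groups with a common subgroup $A$, and let $\Gamma=G*_AH$ be the amalgamated free product. (1) Let $L_G:G\to\mathbb N$ and $L_H:H\to\mathbb N$ be integer-valued length functions that agree on $A$, and suppose $L_G(g)\ge1$ for $g\in G\setminus A$ and $L_H(h)\ge 1$ for $h\in H\setminus A$. For $k\in\Gamma$ let $L(k)$ be the minimum of $L_G(a)+\ell(s_1)+\dots+\ell(s_m)$ over all ways of writing $k=a s_1\cdots s_m$ with $m\ge0$, $a\in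 A$, and letters $s_r$ taken alternately from $G\setminus A$ and $H\setminus A$ (starting with either), where $\ell=L_G$ on $G\setminus A$ and $\ell=L_H$ on $H\setminus A$. Then $L$ is a length function on $\Gamma$; if $(G,L_G)$ and $(H,L_H)$ have RD (resp. SD), then $(\Gamma,L)$ has RD (resp. SD); and if $(G,L_G)$ and $(H,L_H)$ both have $f$-decay for some $f:\mathbb N\to\mathbb R$, then $(\Gamma,L)$ has $\tilde f$-decay with $\tilde f(n)=(2n+1)^{7/2}f(2n)$. (2) Let $L_G$ and $L_H$ be arbitrary length functions on $G$ and $H$ (with values in $[0,\infty)$) that agree on $A$. If $(G,L_G)$ and $(H,L_H)$ have RD (resp. SD), then there is a length function on $\Gamma$ with respect to which $\Gamma$ has RD (resp. SD). -/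

import Mathlib

open Filter Topology

universe u v

noncomputable section

/-- A length function on a group, with values in `[0, ∞)`. -/
structure IsLengthFunction {G : Type u} [Group G] (l : G → ℝ) : Prop where
  nonneg : ∀ g, 0 ≤ l g
  map_one : l 1 = 0
  map_inv : ∀ g, l g⁻¹ = l g
  map_mul_le : ∀ g h, l (g * h) ≤ l g + l h

/-- The Hilbert space `ℓ²(G)`. -/
abbrev EllTwo (G : Type u) : Type u := lp (fun _ : G => ℂ) 2

theorem memℓp_translate {G : Type u} [Group G] (g : G) (ξ : EllTwo G) :
    Memℓp (fun h : G => ξ (g⁻¹ * h)) 2 := by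
  have hp : 0 < (2 : ENNReal).toReal := by norm_num
  have h := (memℓp_gen_iff hp).1 (lp.memℓp ξ)
  exact (memℓp_gen_iff hp).2 ((Equiv.mulLeft g⁻¹).summable_iff.2 h)

/-- The unitary `λ(g)` of the left regular representation: `(λ(g) ξ)(h) = ξ(g⁻¹ h)`. -/
def leftTranslate {G : Type u} [Group G] (g : G) : EllTwo G →ₗᵢ[ℂ] EllTwo G where
  toFun ξ := ⟨fun h => ξ (g⁻¹ * h), memℓp_translate g ξ⟩
  map_add' _ _ := rfl
  map_smul' _ _ := rfl
  norm_map' ξ := by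
    have hp : 0 < (2 : ENNReal).toReal := by norm_num
    rw [lp.norm_eq_tsum_rpow hp, lp.norm_eq_tsum_rpow hp]
    congr 1
    exact (Equiv.mulLeft g⁻¹).tsum_eq (fun h => ‖ξ h‖ ^ (2 : ENNReal).toReal)

theorem leftTranslate_apply {G : Type u} [Group G] (g : G) (ξ : EllTwo G) (h : G) :
    leftTranslate g ξ h = ξ (g⁻¹ * h) := rfl

/-- The left regular representation of `G` on `ℓ²(G)`. -/
def leftRegular (G : Type u) [Group G] : G →* (EllTwo G →L[ℂ] EllTwo G) where
  toFun g := (leftTranslate g).toContinuousLinearMap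
  map_one' := by
    ext ξ h
    simp [leftTranslate_apply]
  map_mul' a b := by
    ext ξ h
    simp [leftTranslate_apply, mul_assoc]

/-- The norm of an element of `ℂ[G]` as an operator on `ℓ²(G)`, through the linear extension of
the left regular representation. -/
def reducedNorm {G : Type u} [Group G] (x : MonoidAlgebra ℂ G) : ℝ :=
  ‖MonoidAlgebra.lift ℂ (EllTwo G →L[ℂ] EllTwo G) G (leftRegular G) x‖

/-- The `2`-norm of an element of `ℂ[G]`. -/
def twoNorm {G : Type u} [Group G] (x : MonoidAlgebra ℂ G) : ℝ :=
  Real.sqrt (∑ g ∈ x.coeff.support, ‖x.coeff g‖ ^ 2)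

/-- `(G, l)` has `f`-decay. -/
def HasDecay {G : Type u} [Group G] (l : G → ℝ) (f : ℕ → ℝ) : Prop :=
  ∀ (n : ℕ) (x : MonoidAlgebra ℂ G), (∀ g ∈ x.coeff.support, l g ≤ n) →
    reducedNorm x ≤ f n * twoNorm x

/-- A function `f : ℕ → [0, ∞)` with `f(n)^(1/n) → 1`. -/
def IsSubexponential (f : ℕ → ℝ) : Prop :=
  (∀ n, 0 ≤ f n) ∧ Tendsto (fun n : ℕ => f n ^ (1 / (n : ℝ))) atTop (𝓝 1)

/-- Rapid decay with respect to `l`. -/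
def HasRD {G : Type u} [Group G] (l : G → ℝ) : Prop :=
  ∃ P : Polynomial ℝ, HasDecay l (fun n => P.eval (n : ℝ))

/-- Subexponential decay with respect to `l`. -/
def HasSD {G : Type u} [Group G] (l : G → ℝ) : Prop :=
  ∃ f : ℕ → ℝ, IsSubexponential f ∧ HasDecay l f

/-- The two factors `G`, `H` as a family. -/
def Factor (G H : Type u) : Bool → Type u
  | false => G
  | true => H

instance Factor.instGroup (G H : Type u) [Group G] [Group H] : ∀ b, Group (Factor G H b)
  | false => inferInstanceAs (Group G)
  | true => inferInstanceAs (Group H)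

/-- The two inclusions of the common subgroup `A`. -/
def factorMap {A : Type v} {G H : Type u} [Group A] [Group G] [Group H]
    (i : A →* G) (j : A →* H) : ∀ b, A →* Factor G H b
  | false => i
  | true => j

/-- The amalgamated free product `G *_A H`, the pushout of `i : A → G` and `j : A → H`. -/
abbrev Amalgam {A : Type v} {G H : Type u} [Group A] [Group G] [Group H]
    (i : A →* G) (j : A →* H) : Type (max u v) :=
  Monoid.PushoutI (factorMap i j)

/-- The length of a letter: `L_G` on letters from `G`, `L_H` on letters from `H`. -/
def letterLength {G H : Type u} (LG : G → ℕ) (LH : H → ℕ) : (Σ b, Factor G H b) → ℕ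
  | ⟨false, g⟩ => LG g
  | ⟨true, h⟩ => LH h

/-- The length on `G *_A H`: the minimum of `L_A(a) + L(s₁) + ⋯ + L(sₘ)` over all ways to write
`k = a s₁ ⋯ sₘ` with `a ∈ A` and letters `sᵢ` taken alternately from `G \ A` and `H \ A`.
Here `L_A` is the restriction of `LG` to `A`. -/
def amalgamLength {A : Type v} {G H : Type u} [Group A] [Group G] [Group H]
    (i : A →* G) (j : A →* H) (LG : G → ℕ) (LH : H → ℕ) (k : Amalgam i j) : ℕ :=
  sInf {n : ℕ | ∃ (a : A) (w : Monoid.CoprodI.Word (Factor G H)),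
    Monoid.PushoutI.Reduced (factorMap i j) w ∧
    Monoid.PushoutI.base (factorMap i j) a * Monoid.PushoutI.ofCoprodI w.prod = k ∧
    n = LG (i a) + (w.toList.map (letterLength LG LH)).sum}

end

open scoped ENNReal

/-! By duality, `f`-decay says that the form `∑ φ(g) ψ(h) χ(gh)`, with `φ` supported on the ball of
radius `n`, is at most `f n` times the product of the 2-norms. It suffices to test nonnegative
functions, so the argument runs in `ℝ≥0∞`, where sums may be reordered freely
(`HasDecay.trilinearBound`, `reducedNorm_le_of_trilinearBound`).

In the amalgam, a product `yz` is governed by its cancellation: `y = y'v` and `z = v⁻¹ t z'`, where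
either `t` lies in `A` and `y' t z'` involves no merging of letters, or `t` is a letter merged with
the last letter of `y'` into another letter. The pairs are sorted by the block lengths `p` of `y'`
and `q` of `v`, and by the factor of the merged letter if there is one (`mem_blockSet`). Since each
letter outside `A` has length at least 1, there are at most `(n+1)² + 2n²` classes.

On one class, let `E` be `A` or the factor of the merged letter. One writes `y = u s v` and `z = v⁻¹
t w` with `s`, `t` in `E` and `u`, `v`, `w` in coset transversals. For fixed `u`, `v`, `w` the sum
over `s`, `t` is the trilinear form of `E`, bounded by hypothesis. The remaining sum over `(u,v)`,
`(v,w)`, `(u,w)` is a Hilbert–Schmidt estimate (`TrilinearBound.tsum_blocks_le`). Uniqueness of such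
factorisations follows from `suffix_unique`. Representatives of minimal length force `L(u) + L(v) ≤
n` whenever `L(usv) ≤ n`, hence `L(s) ≤ 2n`: this is the `2n` in `f(2n)`.

Real-valued lengths are rounded up and increased by 1 off `A`, which reduces part (2) to part (1).
-/

/-- The square of the `ℓ²`-norm of a nonnegative function. -/
noncomputable def sqSum {ι : Type*} (φ : ι → ℝ≥0∞) : ℝ≥0∞ := ∑' i, φ i ^ 2

/-- The trilinear form `∑ φ(g) ψ(h) χ(gh)`. -/
noncomputable def trilinear {G : Type*} [Group G] (φ ψ χ : G → ℝ≥0∞) : ℝ≥0∞ :=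
  ∑' g, ∑' h, φ g * ψ h * χ (g * h)

/-- The trilinear form is bounded by `c` on functions whose first entry is supported on `S`. -/
def TrilinearBound {G : Type*} [Group G] (S : Set G) (c : ℝ≥0∞) : Prop :=
  ∀ φ ψ χ : G → ℝ≥0∞, (∀ g, φ g ≠ 0 → g ∈ S) →
    trilinear φ ψ χ ≤
      c * (sqSum φ ^ (1 / 2 : ℝ) * sqSum ψ ^ (1 / 2 : ℝ) * sqSum χ ^ (1 / 2 : ℝ))

/-! ### Cauchy–Schwarz inequalities for sums in `[0, ∞]`. -/

theorem ENNReal.sq_rpow_half (a : ℝ≥0∞) : (a ^ (1 / 2 : ℝ)) ^ 2 = a := by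
  rw [← ENNReal.rpow_natCast, ← ENNReal.rpow_mul]; norm_num

theorem ENNReal.rpow_half_sq (a : ℝ≥0∞) : (a ^ 2) ^ (1 / 2 : ℝ) = a := by
  rw [← ENNReal.rpow_natCast, ← ENNReal.rpow_mul]; norm_num

theorem ENNReal.tsum_mul_le_sqSum {ι : Type*} (a b : ι → ℝ≥0∞) :
    ∑' i, a i * b i ≤ sqSum a ^ (1 / 2 : ℝ) * sqSum b ^ (1 / 2 : ℝ) := by
  rw [ENNReal.tsum_eq_iSup_sum]
  refine iSup_le fun s => ?_
  refine (ENNReal.inner_le_Lp_mul_Lq s a b (p := 2) (q := 2)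
    (by constructor <;> norm_num)).trans ?_
  simp only [ENNReal.rpow_two]
  gcongr
  · exact ENNReal.sum_le_tsum s
  · exact ENNReal.sum_le_tsum s

theorem ENNReal.sq_tsum_mul_le {ι : Type*} (a b : ι → ℝ≥0∞) :
    (∑' i, a i * b i) ^ 2 ≤ sqSum a * sqSum b := by
  have h := pow_le_pow_left₀ zero_le (ENNReal.tsum_mul_le_sqSum a b) 2
  rwa [mul_pow, ENNReal.sq_rpow_half, ENNReal.sq_rpow_half] at h

/-- The Hilbert–Schmidt bound for the trilinear form `∑ α(u,v) β(v,w) γ(u,w)`. -/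
theorem ENNReal.tsum_triangle_le {U V W : Type*} (α : U → V → ℝ≥0∞) (β : V → W → ℝ≥0∞)
    (γ : U → W → ℝ≥0∞) :
    ∑' u, ∑' v, ∑' w, α u v * β v w * γ u w ≤
      (∑' u, ∑' v, α u v ^ 2) ^ (1 / 2 : ℝ) * (∑' v, ∑' w, β v w ^ 2) ^ (1 / 2 : ℝ) *
        (∑' u, ∑' w, γ u w ^ 2) ^ (1 / 2 : ℝ) := by
  calc ∑' u, ∑' v, ∑' w, α u v * β v w * γ u w
      = ∑' p : U × W, (∑' v, α p.1 v * β v p.2) * γ p.1 p.2 := by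
        rw [ENNReal.tsum_prod (f := fun u w => (∑' v, α u v * β v w) * γ u w)]
        refine tsum_congr fun u => ?_
        rw [ENNReal.tsum_comm]
        exact tsum_congr fun w => ENNReal.tsum_mul_right
    _ ≤ sqSum (fun p : U × W => ∑' v, α p.1 v * β v p.2) ^ (1 / 2 : ℝ) *
          sqSum (fun p : U × W => γ p.1 p.2) ^ (1 / 2 : ℝ) := ENNReal.tsum_mul_le_sqSum _ _
    _ ≤ _ := by
        unfold sqSum
        rw [ENNReal.tsum_prod (f := fun u w => (∑' v, α u v * β v w) ^ 2),
          ENNReal.tsum_prod (f := fun u w => γ u w ^ 2)]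
        refine mul_le_mul' ?_ le_rfl
        rw [← ENNReal.mul_rpow_of_nonneg _ _ (by norm_num : (0 : ℝ) ≤ 1 / 2)]
        gcongr
        calc ∑' u, ∑' w, (∑' v, α u v * β v w) ^ 2
            ≤ ∑' u, ∑' w, (∑' v, α u v ^ 2) * ∑' v, β v w ^ 2 :=
              ENNReal.tsum_le_tsum fun u => ENNReal.tsum_le_tsum fun w =>
                ENNReal.sq_tsum_mul_le _ _
          _ = (∑' u, ∑' v, α u v ^ 2) * ∑' v, ∑' w, β v w ^ 2 := by
              rw [ENNReal.tsum_comm (f := fun v w => β v w ^ 2), ← ENNReal.tsum_mul_right]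
              exact tsum_congr fun u => ENNReal.tsum_mul_left

/-! ### Decay as a trilinear inequality. -/

section Regular

theorem sqSum_enorm {G : Type u} (ξ : EllTwo G) : sqSum (fun g => ‖ξ g‖ₑ) = ‖ξ‖ₑ ^ 2 := by
  have hp : 0 < (2 : ENNReal).toReal := by norm_num
  have h := lp.hasSum_norm hp ξ
  simp only [ENNReal.toReal_ofNat, Real.rpow_two] at h
  have h2 := ENNReal.ofReal_tsum_of_nonneg (fun g => sq_nonneg ‖ξ g‖) h.summable
  rw [h.tsum_eq] at h2
  simp only [ENNReal.ofReal_pow (norm_nonneg _), ofReal_norm] at h2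
  exact h2.symm

theorem exists_ellTwo_of_sqSum_ne_top {G : Type u} (ψ : G → ℝ≥0∞) (h : sqSum ψ ≠ ∞) :
    ∃ ξ : EllTwo G, ∀ g, ξ g = ((ψ g).toReal : ℂ) := by
  have hp : 0 < (2 : ENNReal).toReal := by norm_num
  refine ⟨⟨fun g => ((ψ g).toReal : ℂ), (memℓp_gen_iff hp).2 ?_⟩, fun g => rfl⟩
  have := ENNReal.summable_toReal h
  simpa [ENNReal.toReal_pow] using this

variable {G : Type u} [Group G]

theorem lift_leftRegular_apply (x : MonoidAlgebra ℂ G) (ξ : EllTwo G) (k : G) :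
    (MonoidAlgebra.lift ℂ (EllTwo G →L[ℂ] EllTwo G) G (leftRegular G) x) ξ k =
      ∑ g ∈ x.coeff.support, x.coeff g * ξ (g⁻¹ * k) := by
  rw [MonoidAlgebra.lift_apply, Finsupp.sum, sum_apply,
    lp.coeFn_sum, Finset.sum_apply]
  rfl

theorem enorm_sum_coeff (x : MonoidAlgebra ℂ G) :
    sqSum (fun g => ‖x.coeff g‖ₑ) = ENNReal.ofReal (twoNorm x) ^ 2 := by
  unfold twoNorm sqSum
  rw [← ENNReal.ofReal_pow (Real.sqrt_nonneg _), Real.sq_sqrt (by positivity),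
    ENNReal.ofReal_sum_of_nonneg (fun _ _ => by positivity), tsum_eq_sum (s := x.coeff.support)]
  · simp only [ENNReal.ofReal_pow (norm_nonneg _), ofReal_norm]
  · intro g hg
    simp [Finsupp.notMem_support_iff.1 hg]

/-- A trilinear bound gives a bound for the norm of the regular representation. -/
theorem reducedNorm_le_of_trilinearBound {S : Set G} {c : ℝ} (hc : 0 ≤ c)
    (h : TrilinearBound S (ENNReal.ofReal c)) (x : MonoidAlgebra ℂ G)
    (hx : ∀ g ∈ x.coeff.support, g ∈ S) : reducedNorm x ≤ c * twoNorm x := by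
  have h2 : 0 ≤ twoNorm x := Real.sqrt_nonneg _
  refine ContinuousLinearMap.opNorm_le_bound _ (by positivity) fun ξ => ?_
  set η := (MonoidAlgebra.lift ℂ (EllTwo G →L[ℂ] EllTwo G) G (leftRegular G) x) ξ with hη
  -- Testing against `χ = |η|` gives a bound quadratic in `‖η‖` on the left and linear on the right;
  -- one factor is cancelled at the end.
  have key : ‖η‖ₑ ^ 2 ≤ ENNReal.ofReal c *
      (ENNReal.ofReal (twoNorm x) * ‖ξ‖ₑ * ‖η‖ₑ) := by
    have h1 := h (fun g => ‖x.coeff g‖ₑ) (fun g => ‖ξ g‖ₑ) (fun g => ‖η g‖ₑ)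
      (fun g hg => hx g (by
        rw [Finsupp.mem_support_iff]; intro h0; exact hg (by simp [h0])))
    rw [sqSum_enorm, sqSum_enorm, enorm_sum_coeff] at h1
    simp only [ENNReal.rpow_half_sq] at h1
    refine le_trans ?_ h1
    rw [← sqSum_enorm]
    unfold sqSum trilinear
    calc ∑' k, ‖η k‖ₑ ^ 2 ≤ ∑' k, ∑' g, ‖x.coeff g‖ₑ * ‖ξ (g⁻¹ * k)‖ₑ * ‖η k‖ₑ := by
          refine ENNReal.tsum_le_tsum fun k => ?_
          rw [ENNReal.tsum_mul_right, sq]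
          gcongr
          rw [hη, lift_leftRegular_apply]
          refine (enorm_sum_le _ _).trans ?_
          simp only [enorm_mul]
          exact ENNReal.sum_le_tsum _
      _ = _ := by
          rw [ENNReal.tsum_comm]
          refine tsum_congr fun g => ?_
          rw [← (Equiv.mulLeft g).tsum_eq]
          simp
  by_cases h0 : ‖η‖ = 0
  · rw [h0]; positivity
  have key' : ‖η‖ ^ 2 ≤ c * (twoNorm x * ‖ξ‖ * ‖η‖) := by
    rw [← ofReal_norm, ← ofReal_norm, ← ENNReal.ofReal_pow (norm_nonneg _),
      ← ENNReal.ofReal_mul h2, ← ENNReal.ofReal_mul (by positivity),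
      ← ENNReal.ofReal_mul hc] at key
    exact (ENNReal.ofReal_le_ofReal_iff (by positivity)).1 key
  have hpos : 0 < ‖η‖ := lt_of_le_of_ne (norm_nonneg _) (Ne.symm h0)
  nlinarith

theorem twoNorm_one : twoNorm (1 : MonoidAlgebra ℂ G) = 1 := by
  have h := enorm_sum_coeff (1 : MonoidAlgebra ℂ G)
  have h' : sqSum (fun g => ‖(1 : MonoidAlgebra ℂ G).coeff g‖ₑ) = 1 := by
    unfold sqSum
    rw [tsum_eq_single 1]
    · simp [MonoidAlgebra.one_def]
    · intro g hg
      simp [MonoidAlgebra.one_def, Ne.symm hg]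
  have h0 : 0 ≤ twoNorm (1 : MonoidAlgebra ℂ G) := Real.sqrt_nonneg _
  rw [h', ← ENNReal.ofReal_pow h0, eq_comm, ENNReal.ofReal_eq_one] at h
  exact (pow_eq_one_iff_of_nonneg h0 two_ne_zero).1 h

/-- Test on the unit of `ℂ[G]`, which has both norms equal to 1. Positivity of decay functions,
which is not part of `HasDecay`, comes from here. -/
theorem HasDecay.one_le {l : G → ℝ} {f : ℕ → ℝ} (h : HasDecay l f) (hl : IsLengthFunction l)
    (n : ℕ) : 1 ≤ f n := by
  have h1 := h n 1 (fun g hg => by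
    have : g = 1 := by
      by_contra hne
      exact (Finsupp.mem_support_iff.1 hg) (by
        simp [MonoidAlgebra.one_def, Ne.symm hne])
    rw [this, hl.map_one]; positivity)
  rw [twoNorm_one, mul_one] at h1
  refine le_trans ?_ h1
  unfold reducedNorm
  have : Nontrivial (EllTwo G) := by
    classical
    refine ⟨lp.single 2 (1 : G) (1 : ℂ), 0, fun h0 => ?_⟩
    have := congrArg (fun ξ : EllTwo G => ξ 1) h0
    simp at this
  rw [map_one, norm_one]

theorem sqSum_eq_zero {ι : Type*} {φ : ι → ℝ≥0∞} : sqSum φ = 0 ↔ φ = 0 := by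
  simp [sqSum, ENNReal.tsum_eq_zero, funext_iff]

theorem ne_top_of_sqSum_ne_top {ι : Type*} {φ : ι → ℝ≥0∞} (h : sqSum φ ≠ ∞) (i : ι) :
    φ i ≠ ∞ := by
  intro hi
  exact ENNReal.ne_top_of_tsum_ne_top h i (by simp [hi])

/-- For finite norms, truncate `φ` to a finite set to obtain an element `x` of `ℂ[G]`; the form is
then the pairing of `λ(x)ψ` with `χ`. -/
theorem HasDecay.trilinearBound {l : G → ℝ} {f : ℕ → ℝ} (h : HasDecay l f)
    (hl : IsLengthFunction l) (n : ℕ) :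
    TrilinearBound {g | l g ≤ n} (ENNReal.ofReal (f n)) := by
  intro φ ψ χ hφ
  have hf := h.one_le hl n
  have hc : ENNReal.ofReal (f n) ≠ 0 := by
    rw [Ne, ENNReal.ofReal_eq_zero]; linarith
  -- The vanishing case is settled before the infinite one, so that no product `0 * ∞` occurs on the
  -- right.
  by_cases h0 : sqSum φ = 0 ∨ sqSum ψ = 0 ∨ sqSum χ = 0
  · have : trilinear φ ψ χ = 0 := by
      simp only [sqSum_eq_zero] at h0
      rcases h0 with rfl | rfl | rfl <;> simp [trilinear]
    rw [this]; exact zero_le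
  push Not at h0
  obtain ⟨hφ0, hψ0, hχ0⟩ := h0
  by_cases htop : sqSum φ = ∞ ∨ sqSum ψ = ∞ ∨ sqSum χ = ∞
  · refine le_of_le_of_eq le_top (Eq.symm ?_)
    rcases htop with h1 | h1 | h1 <;>
      simp [h1, hc, hφ0, hψ0, hχ0, ENNReal.top_mul, ENNReal.mul_top]
  push Not at htop
  obtain ⟨hφt, hψt, hχt⟩ := htop
  obtain ⟨ξ, hξ⟩ := exists_ellTwo_of_sqSum_ne_top ψ hψt
  have hξn : sqSum ψ = ‖ξ‖ₑ ^ 2 := by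
    rw [← sqSum_enorm]
    congr 1
    ext g
    rw [hξ, ← ofReal_norm, Complex.norm_real, Real.norm_of_nonneg ENNReal.toReal_nonneg,
      ENNReal.ofReal_toReal (ne_top_of_sqSum_ne_top hψt g)]
  unfold trilinear
  rw [ENNReal.tsum_eq_iSup_sum]
  refine iSup_le fun s => ?_
  classical
  let x : MonoidAlgebra ℂ G := MonoidAlgebra.ofCoeff
    (Finsupp.onFinset s (fun g => if g ∈ s then ((φ g).toReal : ℂ) else 0)
      (fun g hg => by by_contra hs; simp [hs] at hg))
  have hxc : ∀ g, x.coeff g = if g ∈ s then ((φ g).toReal : ℂ) else 0 := fun g => rfl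
  have hxe : ∀ g, ‖x.coeff g‖ₑ = if g ∈ s then φ g else 0 := by
    intro g
    rw [hxc]
    split_ifs
    · rw [← ofReal_norm, Complex.norm_real, Real.norm_of_nonneg ENNReal.toReal_nonneg,
        ENNReal.ofReal_toReal (ne_top_of_sqSum_ne_top hφt g)]
    · simp
  have hxs : x.coeff.support ⊆ s := by
    intro g hg
    by_contra hs
    exact Finsupp.mem_support_iff.1 hg (by rw [hxc, if_neg hs])
  have hx2 : ENNReal.ofReal (twoNorm x) ≤ sqSum φ ^ (1 / 2 : ℝ) := by
    rw [← ENNReal.rpow_half_sq (ENNReal.ofReal _), ← enorm_sum_coeff]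
    gcongr
    refine ENNReal.tsum_le_tsum fun g => ?_
    simp only [hxe]; split_ifs <;> simp
  have hdec := h n x (fun g hg => hφ g (by
    intro h1
    have := hxe g
    rw [h1] at this
    simp at this
    exact (Finsupp.mem_support_iff.1 hg) this))
  set η := (MonoidAlgebra.lift ℂ (EllTwo G →L[ℂ] EllTwo G) G (leftRegular G) x) ξ with hη
  have hηn : ‖η‖ₑ ≤ ENNReal.ofReal (f n) * (sqSum φ ^ (1 / 2 : ℝ) * sqSum ψ ^ (1 / 2 : ℝ)) := by
    have h3 : ‖η‖ ≤ f n * twoNorm x * ‖ξ‖ :=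
      ((MonoidAlgebra.lift ℂ (EllTwo G →L[ℂ] EllTwo G) G (leftRegular G) x).le_opNorm ξ).trans
        (by gcongr; exact hdec)
    have h2 : 0 ≤ twoNorm x := Real.sqrt_nonneg _
    rw [hξn, ENNReal.rpow_half_sq, ← ofReal_norm, ← ofReal_norm ξ]
    refine (ENNReal.ofReal_le_ofReal h3).trans ?_
    rw [ENNReal.ofReal_mul (by positivity), ENNReal.ofReal_mul (by positivity), mul_assoc]
    gcongr
  have hηk : ∀ k, ‖η k‖ₑ = ∑ g ∈ s, φ g * ψ (g⁻¹ * k) := by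
    intro k
    have : η k = ((∑ g ∈ s, φ g * ψ (g⁻¹ * k)).toReal : ℂ) := by
      rw [hη, lift_leftRegular_apply, Finset.sum_subset hxs, ENNReal.toReal_sum]
      · push_cast
        refine Finset.sum_congr rfl fun g hg => ?_
        rw [hxc, if_pos hg, hξ, ENNReal.toReal_mul]
        push_cast; rfl
      · intro g _
        exact ENNReal.mul_ne_top (ne_top_of_sqSum_ne_top hφt g) (ne_top_of_sqSum_ne_top hψt _)
      · intro g _ hg
        simp [Finsupp.notMem_support_iff.1 hg]
    rw [this, ← ofReal_norm, Complex.norm_real, Real.norm_of_nonneg ENNReal.toReal_nonneg,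
      ENNReal.ofReal_toReal]
    exact ENNReal.sum_ne_top.2 fun g _ =>
      ENNReal.mul_ne_top (ne_top_of_sqSum_ne_top hφt g) (ne_top_of_sqSum_ne_top hψt _)
  calc ∑ g ∈ s, ∑' h, φ g * ψ h * χ (g * h)
      = ∑' k, ‖η k‖ₑ * χ k := by
        simp only [hηk, Finset.sum_mul]
        rw [Summable.tsum_finsetSum (fun _ _ => ENNReal.summable)]
        refine Finset.sum_congr rfl fun g _ => ?_
        rw [← (Equiv.mulLeft g).tsum_eq (fun k => φ g * ψ (g⁻¹ * k) * χ k)]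
        simp
    _ ≤ ‖η‖ₑ * sqSum χ ^ (1 / 2 : ℝ) := by
        refine (ENNReal.tsum_mul_le_sqSum _ _).trans ?_
        rw [sqSum_enorm, ENNReal.rpow_half_sq]
    _ ≤ _ := by
        rw [← mul_assoc]
        gcongr

end Regular

/-! ### Transfer of trilinear bounds to subgroups and to block sums. -/

/-- Trilinear bounds pass to subgroups. -/
theorem TrilinearBound.comap {A : Type v} {G : Type u} [Group A] [Group G] (i : A →* G)
    (hi : Function.Injective i) {S : Set G} {c : ℝ≥0∞} (h : TrilinearBound S c) :
    TrilinearBound (i ⁻¹' S) c := by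
  intro φ ψ χ hφ
  have hext : ∀ φ : A → ℝ≥0∞, sqSum (Function.extend i φ 0) = sqSum φ := by
    intro φ
    unfold sqSum
    rw [← tsum_extend_zero hi]
    refine tsum_congr fun g => ?_
    by_cases hg : ∃ a, i a = g
    · obtain ⟨a, rfl⟩ := hg
      simp [hi.extend_apply]
    · simp [Function.extend_apply' _ _ _ hg]
  have h1 := h (Function.extend i φ 0) (Function.extend i ψ 0) (Function.extend i χ 0) (by
    intro g hg
    by_cases hg' : ∃ a, i a = g
    · obtain ⟨a, rfl⟩ := hg'
      rw [hi.extend_apply] at hg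
      exact hφ a hg
    · exact absurd (by simp [Function.extend_apply' _ _ _ hg']) hg)
  rw [hext, hext, hext] at h1
  refine le_trans ?_ h1
  unfold trilinear
  rw [← ENNReal.tsum_prod, ← ENNReal.tsum_prod]
  refine le_trans (le_of_eq ?_) (ENNReal.tsum_comp_le_tsum_of_injective
    (f := Prod.map i i) (hi.prodMap hi) _)
  refine tsum_congr fun p => ?_
  simp only [Prod.map_fst, Prod.map_snd, ← map_mul, hi.extend_apply]

/-- The trilinear form of blocks: sums over factorisations `y = u s v`, `z = v⁻¹ t w` with
`s`, `t` in a group for which a trilinear bound holds. -/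
theorem TrilinearBound.tsum_blocks_le {K : Type u} {Γ : Type v} [Group K] [Group Γ] (κ : K →* Γ)
    {S : Set K} {c : ℝ≥0∞} (hS : TrilinearBound S c) (U V W : Set Γ)
    (P Q R : Γ → K → Γ → Prop) (φ ψ χ : Γ → ℝ≥0∞)
    (hsupp : ∀ u ∈ U, ∀ v ∈ V, ∀ s, P u s v → φ (u * κ s * v) ≠ 0 → s ∈ S)
    (hP : ∀ u ∈ U, ∀ u' ∈ U, ∀ v ∈ V, ∀ v' ∈ V, ∀ s s', P u s v → P u' s' v' →
      u * κ s * v = u' * κ s' * v' → u = u' ∧ s = s' ∧ v = v')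
    (hQ : ∀ v ∈ V, ∀ v' ∈ V, ∀ w ∈ W, ∀ w' ∈ W, ∀ s s', Q v s w → Q v' s' w' →
      v⁻¹ * κ s * w = v'⁻¹ * κ s' * w' → v = v' ∧ s = s' ∧ w = w')
    (hR : ∀ u ∈ U, ∀ u' ∈ U, ∀ w ∈ W, ∀ w' ∈ W, ∀ s s', R u s w → R u' s' w' →
      u * κ s * w = u' * κ s' * w' → u = u' ∧ s = s' ∧ w = w') :
    ∑' p : {p : (U × V × W) × K × K // P p.1.1 p.2.1 p.1.2.1 ∧ Q p.1.2.1 p.2.2 p.1.2.2 ∧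
        R p.1.1 (p.2.1 * p.2.2) p.1.2.2},
      φ (p.1.1.1 * κ p.1.2.1 * p.1.1.2.1) *
        ψ ((p.1.1.2.1 : Γ)⁻¹ * κ p.1.2.2 * p.1.1.2.2) *
        χ (p.1.1.1 * κ (p.1.2.1 * p.1.2.2) * p.1.1.2.2) ≤
      c * (sqSum φ ^ (1 / 2 : ℝ) * sqSum ψ ^ (1 / 2 : ℝ) * sqSum χ ^ (1 / 2 : ℝ)) := by
  classical
  -- The functions on `Γ` are cut into functions on `K` indexed by pairs of representatives. As
  -- factorisations are unique, the squared norms of the pieces add up to at most the squared norm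
  -- of the original (`bound`).
  let Φ : U → V → K → ℝ≥0∞ := fun u v s => if P u s v then φ (u * κ s * v) else 0
  let Ψ : V → W → K → ℝ≥0∞ := fun v w s => if Q v s w then ψ ((v : Γ)⁻¹ * κ s * w) else 0
  let X : U → W → K → ℝ≥0∞ := fun u w s => if R u s w then χ (u * κ s * w) else 0
  have bound : ∀ {I J : Set Γ} (F : I → J → K → Γ) (C : I → J → K → Prop) (θ : Γ → ℝ≥0∞),
      (∀ a a' b b' s s', C a b s → C a' b' s' → F a b s = F a' b' s' → a = a' ∧ s = s' ∧ b = b') →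
      ∑' a, ∑' b, (sqSum (fun s => if C a b s then θ (F a b s) else 0) ^ (1 / 2 : ℝ)) ^ 2 ≤
        sqSum θ := by
    intro I J F C θ hinj
    simp only [ENNReal.sq_rpow_half]
    unfold sqSum
    simp only [← ENNReal.tsum_prod]
    have : ∀ p : I × J × K, (if C p.1 p.2.1 p.2.2 then θ (F p.1 p.2.1 p.2.2) else 0) ^ 2 =
        Set.indicator {p : I × J × K | C p.1 p.2.1 p.2.2}
          (fun p => θ (F p.1 p.2.1 p.2.2) ^ 2) p := by
      intro p
      simp only [Set.indicator, Set.mem_ofPred_eq]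
      split_ifs <;> simp
    simp only [this]
    rw [← tsum_subtype]
    refine ENNReal.tsum_comp_le_tsum_of_injective
      (f := fun p : {p : I × J × K | C p.1 p.2.1 p.2.2} => F p.1.1 p.1.2.1 p.1.2.2) ?_
      (fun k => θ k ^ 2)
    rintro ⟨⟨a, b, s⟩, h1⟩ ⟨⟨a', b', s'⟩, h2⟩ h3
    obtain ⟨rfl, rfl, rfl⟩ := hinj a a' b b' s s' h1 h2 h3
    rfl
  calc _ ≤ ∑' p : (U × V × W) × K × K,
        Φ p.1.1 p.1.2.1 p.2.1 * Ψ p.1.2.1 p.1.2.2 p.2.2 * X p.1.1 p.1.2.2 (p.2.1 * p.2.2) := by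
        refine le_trans (le_of_eq ?_) (ENNReal.tsum_comp_le_tsum_of_injective
          (f := fun p : {p : (U × V × W) × K × K // P p.1.1 p.2.1 p.1.2.1 ∧
            Q p.1.2.1 p.2.2 p.1.2.2 ∧ R p.1.1 (p.2.1 * p.2.2) p.1.2.2} => p.1)
          Subtype.val_injective _)
        refine tsum_congr fun p => ?_
        simp only [Φ, Ψ, X, if_pos p.2.1, if_pos p.2.2.1, if_pos p.2.2.2]
    _ = ∑' u, ∑' v, ∑' w, trilinear (Φ u v) (Ψ v w) (X u w) := by
        simp only [trilinear]
        rw [ENNReal.tsum_prod (f := fun (q : U × V × W) (r : K × K) =>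
          Φ q.1 q.2.1 r.1 * Ψ q.2.1 q.2.2 r.2 * X q.1 q.2.2 (r.1 * r.2)),
          ENNReal.tsum_prod (f := fun (u : U) (q : V × W) => ∑' r : K × K,
          Φ u q.1 r.1 * Ψ q.1 q.2 r.2 * X u q.2 (r.1 * r.2))]
        refine tsum_congr fun u => ?_
        rw [ENNReal.tsum_prod (f := fun (v : V) (w : W) => ∑' r : K × K,
          Φ u v r.1 * Ψ v w r.2 * X u w (r.1 * r.2))]
        refine tsum_congr fun v => tsum_congr fun w => ?_
        rw [ENNReal.tsum_prod (f := fun s t => Φ u v s * Ψ v w t * X u w (s * t))]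
    _ ≤ ∑' u, ∑' v, ∑' w, c * (sqSum (Φ u v) ^ (1 / 2 : ℝ) * sqSum (Ψ v w) ^ (1 / 2 : ℝ) *
          sqSum (X u w) ^ (1 / 2 : ℝ)) := by
        refine ENNReal.tsum_le_tsum fun u => ENNReal.tsum_le_tsum fun v =>
          ENNReal.tsum_le_tsum fun w => hS _ _ _ fun s hs => ?_
        by_cases h : P u s v
        · exact hsupp u u.2 v v.2 s h (by simpa [Φ, h] using hs)
        · simp [Φ, h] at hs
    _ ≤ _ := by
        simp only [ENNReal.tsum_mul_left]
        gcongr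
        refine (ENNReal.tsum_triangle_le (fun u v => sqSum (Φ u v) ^ (1 / 2 : ℝ))
          (fun v w => sqSum (Ψ v w) ^ (1 / 2 : ℝ))
          (fun u w => sqSum (X u w) ^ (1 / 2 : ℝ))).trans ?_
        gcongr
        · refine bound (fun u v s => u * κ s * v) (fun u v s => P u s v) φ ?_
          intro a a' b b' s s' h1 h2 h3
          have := hP a a.2 a' a'.2 b b.2 b' b'.2 s s' h1 h2 h3
          exact ⟨Subtype.ext this.1, this.2.1, Subtype.ext this.2.2⟩
        · refine bound (fun v w s => (v : Γ)⁻¹ * κ s * w) (fun v w s => Q v s w) ψ ?_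
          intro a a' b b' s s' h1 h2 h3
          have := hQ a a.2 a' a'.2 b b.2 b' b'.2 s s' h1 h2 h3
          exact ⟨Subtype.ext this.1, this.2.1, Subtype.ext this.2.2⟩
        · refine bound (fun u w s => u * κ s * w) (fun u w s => R u s w) χ ?_
          intro a a' b b' s s' h1 h2 h3
          have := hR a a.2 a' a'.2 b b.2 b' b'.2 s s' h1 h2 h3
          exact ⟨Subtype.ext this.1, this.2.1, Subtype.ext this.2.2⟩

open Monoid Monoid.PushoutI

/-! ### Reduced expressions and word lengths in amalgamated products. -/

section Words

variable {ι : Type*} {K : ι → Type*} {A : Type*} [∀ i, Group (K i)] [Group A]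
  (φ : ∀ i, A →* K i)

/-- A list of letters outside the base group, with adjacent letters in different factors. -/
def IsReducedList (l : List (Σ i, K i)) : Prop :=
  (∀ s ∈ l, s.2 ∉ (φ s.1).range) ∧ (l.map Sigma.fst).IsChain (· ≠ ·)

/-- The product of a list of letters in the amalgamated product. -/
def listProd (l : List (Σ i, K i)) : PushoutI φ := (l.map fun s => of s.1 s.2).prod

@[simp] theorem listProd_nil : listProd φ [] = 1 := rfl

@[simp] theorem listProd_cons (s : Σ i, K i) (l : List (Σ i, K i)) :
    listProd φ (s :: l) = of s.1 s.2 * listProd φ l := by simp [listProd]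

@[simp] theorem listProd_append (l m : List (Σ i, K i)) :
    listProd φ (l ++ m) = listProd φ l * listProd φ m := by simp [listProd]

/-- The length on an amalgamated product given by the lengths of letters. -/
noncomputable def wordLength (ℓ₀ : A → ℕ) (ℓ : (Σ i, K i) → ℕ) (k : PushoutI φ) : ℕ :=
  sInf {n : ℕ | ∃ (a : A) (l : List (Σ i, K i)), IsReducedList φ l ∧
    base φ a * listProd φ l = k ∧ n = ℓ₀ a + (l.map ℓ).sum}

/-- Compatible lengths on the base group and on the letters. -/
structure IsLetterLength (ℓ₀ : A → ℕ) (ℓ : (Σ i, K i) → ℕ) : Prop where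
  base_one : ℓ₀ 1 = 0
  base_inv : ∀ a, ℓ₀ a⁻¹ = ℓ₀ a
  base_mul : ∀ a b, ℓ₀ (a * b) ≤ ℓ₀ a + ℓ₀ b
  compat : ∀ i a, ℓ ⟨i, φ i a⟩ = ℓ₀ a
  inv : ∀ i (x : K i), ℓ ⟨i, x⁻¹⟩ = ℓ ⟨i, x⟩
  mul : ∀ i (x y : K i), ℓ ⟨i, x * y⟩ ≤ ℓ ⟨i, x⟩ + ℓ ⟨i, y⟩

variable {φ}

theorem isReducedList_nil : IsReducedList φ [] := by simp [IsReducedList]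

theorem isReducedList_singleton {i : ι} {g : K i} (hg : g ∉ (φ i).range) :
    IsReducedList φ [⟨i, g⟩] := ⟨by simpa using hg, by simp⟩

theorem IsReducedList.of_append_left {l m : List (Σ i, K i)} (h : IsReducedList φ (l ++ m)) :
    IsReducedList φ l := by
  refine ⟨fun s hs => h.1 s (by simp [hs]), ?_⟩
  have := h.2
  rw [List.map_append] at this
  exact this.left_of_append

theorem IsReducedList.of_append_right {l m : List (Σ i, K i)} (h : IsReducedList φ (l ++ m)) :
    IsReducedList φ m := by
  refine ⟨fun s hs => h.1 s (by simp [hs]), ?_⟩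
  have := h.2
  rw [List.map_append] at this
  exact this.right_of_append

theorem IsReducedList.tail {s : Σ i, K i} {l : List (Σ i, K i)}
    (h : IsReducedList φ (s :: l)) : IsReducedList φ l :=
  IsReducedList.of_append_right (l := [s]) h

theorem mul_notMem_range_left {i : ι} (a : A) {g : K i} (hg : g ∉ (φ i).range) :
    φ i a * g ∉ (φ i).range := fun h =>
  hg (((φ i).range.mul_mem_cancel_left ⟨a, rfl⟩).1 h)

theorem mul_notMem_range_right {i : ι} (a : A) {g : K i} (hg : g ∉ (φ i).range) :
    g * φ i a ∉ (φ i).range := fun h =>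
  hg (((φ i).range.mul_mem_cancel_right ⟨a, rfl⟩).1 h)

/-- Multiplying a reduced expression by a letter on the left. -/
theorem IsLetterLength.exists_letter_mul {ℓ₀ : A → ℕ} {ℓ : (Σ i, K i) → ℕ}
    (hℓ : IsLetterLength φ ℓ₀ ℓ) (i : ι) (x : K i) (a : A) {l : List (Σ i, K i)}
    (hl : IsReducedList φ l) :
    ∃ a' l', IsReducedList φ l' ∧
      base φ a' * listProd φ l' = of i x * (base φ a * listProd φ l) ∧
      ℓ₀ a' + (l'.map ℓ).sum ≤ ℓ ⟨i, x⟩ + (ℓ₀ a + (l.map ℓ).sum) := by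
  by_cases hx : x ∈ (φ i).range
  · obtain ⟨b, rfl⟩ := hx
    refine ⟨b * a, l, hl, by rw [of_apply_eq_base, map_mul, mul_assoc], ?_⟩
    have := hℓ.base_mul b a
    have := hℓ.compat i b
    omega
  have hxa : ℓ ⟨i, x * φ i a⟩ ≤ ℓ ⟨i, x⟩ + ℓ₀ a := by
    rw [← hℓ.compat i a]; exact hℓ.mul i _ _
  -- The case without merging: `a` is absorbed into `x`, which becomes a new first letter.
  have hnew : ∀ (m : List (Σ i, K i)), IsReducedList φ m →
      (m.map Sigma.fst).head? ≠ some i → ∃ a' l', IsReducedList φ l' ∧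
      base φ a' * listProd φ l' = of i x * (base φ a * listProd φ m) ∧
      ℓ₀ a' + (l'.map ℓ).sum ≤ ℓ ⟨i, x⟩ + (ℓ₀ a + (m.map ℓ).sum) := by
    intro m hm hhead
    refine ⟨1, ⟨i, x * φ i a⟩ :: m, ⟨?_, ?_⟩, ?_, ?_⟩
    · intro s hs
      rcases List.mem_cons.1 hs with rfl | hs
      · exact mul_notMem_range_right a hx
      · exact hm.1 s hs
    · rw [List.map_cons, List.isChain_cons]
      refine ⟨fun y hy h => hhead ?_, hm.2⟩
      rw [Option.mem_def.1 hy]; exact congrArg some h.symm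
    · simp only [listProd_cons, map_mul, of_apply_eq_base, map_one, one_mul, mul_assoc]
    · simp only [List.map_cons, List.sum_cons, hℓ.base_one]
      omega
  rcases l with _ | ⟨⟨j, y⟩, m⟩
  · exact hnew [] hl (by simp)
  by_cases hij : j = i
  · subst hij
    have hy : ℓ ⟨j, x * φ j a * y⟩ ≤ ℓ ⟨j, x⟩ + ℓ₀ a + ℓ ⟨j, y⟩ :=
      (hℓ.mul j _ _).trans (by omega)
    -- Merging with the first letter either produces an element of the base group or a new letter.
    -- Subadditivity inside the factor controls the length in both cases.
    by_cases hr : x * φ j a * y ∈ (φ j).range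
    · obtain ⟨b, hb⟩ := hr
      refine ⟨b, m, hl.tail, ?_, ?_⟩
      · rw [← of_apply_eq_base φ j b, hb]
        simp only [listProd_cons, map_mul, of_apply_eq_base, mul_assoc]
      · rw [← hb, hℓ.compat] at hy
        simp only [List.map_cons, List.sum_cons]
        omega
    · refine ⟨1, ⟨j, x * φ j a * y⟩ :: m, ⟨?_, hl.2⟩, ?_, ?_⟩
      · intro s hs
        rcases List.mem_cons.1 hs with rfl | hs
        · exact hr
        · exact hl.1 s (List.mem_cons_of_mem _ hs)
      · simp only [listProd_cons, map_mul, of_apply_eq_base, map_one, one_mul, mul_assoc]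
      · simp only [List.map_cons, List.sum_cons, hℓ.base_one]
        omega
  · exact hnew _ hl (by simpa using hij)

/-- Generators act on reduced expressions by `IsLetterLength.exists_letter_mul`; the zero length
serves only to invoke that lemma. -/
theorem exists_reduced_expression (k : PushoutI φ) :
    ∃ a l, IsReducedList φ l ∧ base φ a * listProd φ l = k := by
  have h0 : IsLetterLength φ (fun _ => 0) (fun _ => 0) :=
    ⟨rfl, fun _ => rfl, fun _ _ => le_rfl, fun _ _ => rfl, fun _ _ => rfl, fun _ _ _ => le_rfl⟩
  -- An arbitrary reduced right factor is carried along, so that the product case of the induction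
  -- is a composition.
  suffices ∀ a l, IsReducedList φ l → ∃ a' l', IsReducedList φ l' ∧
      base φ a' * listProd φ l' = k * (base φ a * listProd φ l) by
    obtain ⟨a, l, hl, h⟩ := this 1 [] isReducedList_nil
    exact ⟨a, l, hl, by simpa using h⟩
  induction k using PushoutI.induction_on with
  | of i g =>
    intro a l hl
    obtain ⟨a', l', hl', h, -⟩ := h0.exists_letter_mul i g a hl
    exact ⟨a', l', hl', h⟩
  | base b =>
    intro a l hl
    exact ⟨b * a, l, hl, by rw [map_mul, mul_assoc]⟩
  | mul x y hx hy =>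
    intro a l hl
    obtain ⟨a', l', hl', h⟩ := hy a l hl
    obtain ⟨a'', l'', hl'', h'⟩ := hx a' l' hl'
    exact ⟨a'', l'', hl'', by rw [h', h, mul_assoc]⟩

section Length

variable {ℓ₀ : A → ℕ} {ℓ : (Σ i, K i) → ℕ}

theorem wordLength_le (a : A) {l : List (Σ i, K i)} (hl : IsReducedList φ l) :
    wordLength φ ℓ₀ ℓ (base φ a * listProd φ l) ≤ ℓ₀ a + (l.map ℓ).sum :=
  Nat.sInf_le ⟨a, l, hl, rfl, rfl⟩

theorem exists_wordLength_eq (ℓ₀ : A → ℕ) (ℓ : (Σ i, K i) → ℕ) (k : PushoutI φ) :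
    ∃ a l, IsReducedList φ l ∧ base φ a * listProd φ l = k ∧
      wordLength φ ℓ₀ ℓ k = ℓ₀ a + (l.map ℓ).sum := by
  obtain ⟨a, l, hl, h⟩ := exists_reduced_expression k
  exact Nat.sInf_mem (s := {n : ℕ | ∃ (a : A) (l : List (Σ i, K i)), IsReducedList φ l ∧
    base φ a * listProd φ l = k ∧ n = ℓ₀ a + (l.map ℓ).sum}) ⟨_, a, l, hl, h, rfl⟩

theorem wordLength_letter_mul (hℓ : IsLetterLength φ ℓ₀ ℓ) (i : ι) (x : K i) (k : PushoutI φ) :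
    wordLength φ ℓ₀ ℓ (of i x * k) ≤ ℓ ⟨i, x⟩ + wordLength φ ℓ₀ ℓ k := by
  obtain ⟨a, l, hl, rfl, h⟩ := exists_wordLength_eq ℓ₀ ℓ k
  obtain ⟨a', l', hl', h', hle⟩ := hℓ.exists_letter_mul i x a hl
  rw [h, ← h']
  exact (wordLength_le a' hl').trans hle

theorem wordLength_base_mul (hℓ : IsLetterLength φ ℓ₀ ℓ) (b : A) (k : PushoutI φ) :
    wordLength φ ℓ₀ ℓ (base φ b * k) ≤ ℓ₀ b + wordLength φ ℓ₀ ℓ k := by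
  obtain ⟨a, l, hl, rfl, h⟩ := exists_wordLength_eq ℓ₀ ℓ k
  rw [h, ← mul_assoc, ← map_mul]
  refine (wordLength_le (b * a) hl).trans ?_
  have := hℓ.base_mul b a
  omega

theorem wordLength_one (hℓ : IsLetterLength φ ℓ₀ ℓ) : wordLength φ ℓ₀ ℓ 1 = 0 := by
  have := wordLength_le (φ := φ) (ℓ₀ := ℓ₀) (ℓ := ℓ) 1 isReducedList_nil
  simpa [hℓ.base_one] using this

theorem wordLength_of_le (hℓ : IsLetterLength φ ℓ₀ ℓ)
    (i : ι) (x : K i) : wordLength φ ℓ₀ ℓ (of i x) ≤ ℓ ⟨i, x⟩ := by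
  simpa [wordLength_one hℓ] using wordLength_letter_mul hℓ i x 1

theorem wordLength_base_le (hℓ : IsLetterLength φ ℓ₀ ℓ)
    (a : A) : wordLength φ ℓ₀ ℓ (base φ a) ≤ ℓ₀ a := by
  simpa [wordLength_one hℓ] using wordLength_base_mul hℓ a 1

theorem wordLength_mul_le (hℓ : IsLetterLength φ ℓ₀ ℓ) (k k' : PushoutI φ) :
    wordLength φ ℓ₀ ℓ (k * k') ≤ wordLength φ ℓ₀ ℓ k + wordLength φ ℓ₀ ℓ k' := by
  obtain ⟨a, l, hl, rfl, h⟩ := exists_wordLength_eq ℓ₀ ℓ k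
  rw [h, mul_assoc, add_assoc]
  refine (wordLength_base_mul hℓ a _).trans (Nat.add_le_add_left ?_ _)
  clear h hl
  induction l with
  | nil => simp
  | cons s l ih =>
    rw [listProd_cons, mul_assoc, List.map_cons, List.sum_cons, add_assoc]
    exact (wordLength_letter_mul hℓ _ _ _).trans (Nat.add_le_add_left ih _)

theorem wordLength_inv_le (hℓ : IsLetterLength φ ℓ₀ ℓ) (k : PushoutI φ) :
    wordLength φ ℓ₀ ℓ k⁻¹ ≤ wordLength φ ℓ₀ ℓ k := by
  obtain ⟨a, l, hl, rfl, h⟩ := exists_wordLength_eq ℓ₀ ℓ k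
  rw [h, mul_inv_rev, ← map_inv]
  refine (wordLength_mul_le hℓ _ _).trans ?_
  rw [add_comm]
  refine Nat.add_le_add ((wordLength_base_le hℓ _).trans (hℓ.base_inv a).le) ?_
  clear h hl
  induction l with
  | nil => simp [wordLength_one hℓ]
  | cons s l ih =>
    rw [listProd_cons, mul_inv_rev, List.map_cons, List.sum_cons, add_comm, ← map_inv]
    exact (wordLength_mul_le hℓ _ _).trans
      (Nat.add_le_add ih ((wordLength_of_le hℓ _ _).trans (hℓ.inv _ _).le))

theorem wordLength_inv (hℓ : IsLetterLength φ ℓ₀ ℓ) (k : PushoutI φ) :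
    wordLength φ ℓ₀ ℓ k⁻¹ = wordLength φ ℓ₀ ℓ k :=
  le_antisymm (wordLength_inv_le hℓ k) (by simpa using wordLength_inv_le hℓ k⁻¹)

theorem wordLength_isLengthFunction (hℓ : IsLetterLength φ ℓ₀ ℓ) :
    IsLengthFunction (fun k => (wordLength φ ℓ₀ ℓ k : ℝ)) where
  nonneg _ := Nat.cast_nonneg _
  map_one := by simp [wordLength_one hℓ]
  map_inv k := by simp [wordLength_inv hℓ]
  map_mul_le k k' := by exact_mod_cast wordLength_mul_le hℓ k k'

end Length

/-! ### Block length and uniqueness of reduced factorisations. -/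

open Classical in
variable (φ) in
/-- The number of letters in a reduced expression. -/
noncomputable def blockLength (k : PushoutI φ) : ℕ :=
  wordLength φ (fun _ => 0) (fun s => if s.2 ∈ (φ s.1).range then 0 else 1) k

-- The indicator of the complement of a subgroup is a length, so the block length inherits
-- subadditivity and invariance under inversion from `wordLength`.
open Classical in
theorem isLetterLength_block :
    IsLetterLength φ (fun _ => 0) (fun s => if s.2 ∈ (φ s.1).range then 0 else 1) where
  base_one := rfl
  base_inv _ := rfl
  base_mul _ _ := le_rfl
  compat i a := by simp
  inv i x := by simp only [inv_mem_iff]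
  mul i x y := by
    dsimp only
    by_cases hx : x ∈ (φ i).range
    · by_cases hy : y ∈ (φ i).range
      · rw [if_pos (mul_mem hx hy)]; exact Nat.zero_le _
      · rw [if_neg hy]; split_ifs <;> simp
    · rw [if_neg hx]; split_ifs <;> simp

theorem blockLength_mul_le (k k' : PushoutI φ) :
    blockLength φ (k * k') ≤ blockLength φ k + blockLength φ k' :=
  wordLength_mul_le isLetterLength_block k k'

theorem blockLength_inv (k : PushoutI φ) : blockLength φ k⁻¹ = blockLength φ k :=
  wordLength_inv isLetterLength_block k

theorem blockLength_base (a : A) : blockLength φ (base φ a) = 0 :=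
  Nat.le_zero.1 (wordLength_base_le isLetterLength_block a)

theorem blockLength_base_mul (a : A) (k : PushoutI φ) :
    blockLength φ (base φ a * k) = blockLength φ k := by
  have h1 := blockLength_mul_le (base φ a) k
  have h2 := blockLength_mul_le (base φ a⁻¹) (base φ a * k)
  rw [blockLength_base] at h1 h2
  rw [← mul_assoc, ← map_mul, inv_mul_cancel, map_one, one_mul] at h2
  omega

theorem blockLength_mul_base (k : PushoutI φ) (a : A) :
    blockLength φ (k * base φ a) = blockLength φ k := by
  rw [← blockLength_inv, mul_inv_rev, ← map_inv, blockLength_base_mul, blockLength_inv]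

theorem blockLength_of_le (i : ι) (x : K i) : blockLength φ (of i x) ≤ 1 := by
  classical
  refine (wordLength_of_le isLetterLength_block i x).trans ?_
  split_ifs <;> simp

theorem exists_normalWord_of_reducedList (d : NormalWord.Transversal φ) (a : A)
    {l : List (Σ i, K i)} (hl : IsReducedList φ l) :
    ∃ w : NormalWord d, w.prod = base φ a * listProd φ l ∧ w.toList.length = l.length := by
  let w₀ : CoprodI.Word K := ⟨l, fun s hs h => hl.1 s hs (h ▸ one_mem _), by
    have := hl.2
    rwa [List.isChain_map] at this⟩
  obtain ⟨w, hw, hlen⟩ := Reduced.exists_normalWord_prod_eq d (φ := φ) (w := w₀) hl.1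
  refine ⟨a • w, ?_, ?_⟩
  · rw [NormalWord.prod_base_smul, hw]
    congr 1
    simp only [CoprodI.Word.prod, map_list_prod, List.map_map, listProd, w₀]
    congr 1
  · have := congrArg List.length hlen
    rwa [List.length_map, List.length_map] at this

/-- A reduced expression and its normal form have equally many letters, and a normal form is
determined by its product. -/
theorem length_eq_of_prod_eq (hφ : ∀ i, Function.Injective (φ i))
    {a a' : A} {l l' : List (Σ i, K i)} (hl : IsReducedList φ l)
    (hl' : IsReducedList φ l') (h : base φ a * listProd φ l = base φ a' * listProd φ l') :
    l.length = l'.length := by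
  obtain ⟨d⟩ := NormalWord.transversal_nonempty φ hφ
  obtain ⟨w, hw, hwl⟩ := exists_normalWord_of_reducedList d a hl
  obtain ⟨w', hw', hwl'⟩ := exists_normalWord_of_reducedList d a' hl'
  have : w = w' := NormalWord.prod_injective (by rw [hw, hw', h])
  rw [← hwl, ← hwl', this]

theorem blockLength_eq (hφ : ∀ i, Function.Injective (φ i))
    (a : A) {l : List (Σ i, K i)} (hl : IsReducedList φ l) :
    blockLength φ (base φ a * listProd φ l) = l.length := by
  classical
  obtain ⟨a', l', hl', h, hlen⟩ := exists_wordLength_eq (φ := φ) (fun _ => 0)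
    (fun s => if s.2 ∈ (φ s.1).range then 0 else 1) (base φ a * listProd φ l)
  have hmap : l'.map (fun s => if s.2 ∈ (φ s.1).range then 0 else 1) = l'.map (fun _ => 1) :=
    List.map_congr_left fun s hs => if_neg (hl'.1 s hs)
  rw [hmap] at hlen
  rw [← length_eq_of_prod_eq hφ hl' hl h]
  unfold blockLength
  rw [hlen]
  simp

theorem blockLength_listProd (hφ : ∀ i, Function.Injective (φ i))
    {l : List (Σ i, K i)} (hl : IsReducedList φ l) :
    blockLength φ (listProd φ l) = l.length := by
  simpa using blockLength_eq hφ 1 hl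

theorem blockLength_of (hφ : ∀ i, Function.Injective (φ i))
    {i : ι} {x : K i} (hx : x ∉ (φ i).range) :
    blockLength φ (of i x) = 1 := by
  simpa using blockLength_listProd hφ (isReducedList_singleton hx)

theorem blockLength_eq_zero (hφ : ∀ i, Function.Injective (φ i))
    {k : PushoutI φ} (h : blockLength φ k = 0) :
    k ∈ (base φ).range := by
  obtain ⟨a, l, hl, rfl⟩ := exists_reduced_expression k
  rw [blockLength_eq hφ a hl, List.length_eq_zero_iff] at h
  subst h
  exact ⟨a, by simp⟩

/-- Either no reduction happens in a product, or the adjacent letters lie in the same factor. -/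
theorem blockLength_mul_cases (hφ : ∀ i, Function.Injective (φ i)) (y z : PushoutI φ) :
    blockLength φ (y * z) = blockLength φ y + blockLength φ z ∨
    ∃ (i : ι) (g h : K i) (y₁ z₁ : PushoutI φ), y = y₁ * of i g ∧ z = of i h * z₁ ∧
      g ∉ (φ i).range ∧ h ∉ (φ i).range ∧
      blockLength φ y = blockLength φ y₁ + 1 ∧ blockLength φ z = blockLength φ z₁ + 1 ∧
      (g * h ∉ (φ i).range →
        blockLength φ (y₁ * of i (g * h) * z₁) = blockLength φ y₁ + 1 + blockLength φ z₁) := by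
  obtain ⟨a, l, hl, rfl⟩ := exists_reduced_expression y
  obtain ⟨b, m, hm, rfl⟩ := exists_reduced_expression z
  rcases List.eq_nil_or_concat' l with rfl | ⟨l, ⟨i, g⟩, rfl⟩
  · left
    simp only [listProd_nil, mul_one, blockLength_base_mul, blockLength_base, zero_add]
  rcases m with _ | ⟨⟨j, h⟩, m⟩
  · left
    simp only [listProd_nil, mul_one, blockLength_mul_base, blockLength_base, add_zero]
  have hg : g ∉ (φ i).range := hl.1 ⟨i, g⟩ (by simp)
  have hh : h ∉ (φ j).range := hm.1 ⟨j, h⟩ (by simp)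
  by_cases hij : i = j
  · subst hij
    right
    refine ⟨i, g, φ i b * h, base φ a * listProd φ l, listProd φ m, ?_, ?_, hg,
      mul_notMem_range_left b hh, ?_, ?_, ?_⟩
    · simp [mul_assoc]
    · simp [of_apply_eq_base, mul_assoc]
    · rw [blockLength_eq hφ a hl, blockLength_eq hφ a hl.of_append_left]; simp
    · rw [blockLength_eq hφ b hm, blockLength_listProd hφ hm.tail]; simp
    · intro hr
      have hred : IsReducedList φ (l ++ ⟨i, g * (φ i b * h)⟩ :: m) := by
        refine ⟨?_, ?_⟩
        · intro s hs
          rcases List.mem_append.1 hs with hs | hs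
          · exact hl.1 s (by simp [hs])
          · rcases List.mem_cons.1 hs with rfl | hs
            · exact hr
            · exact hm.1 s (by simp [hs])
        · rw [List.map_append, List.map_cons, List.isChain_split]
          exact ⟨by simpa using hl.2, hm.2⟩
      have := blockLength_eq hφ a hred
      rw [listProd_append, listProd_cons] at this
      rw [mul_assoc, mul_assoc, this, blockLength_eq hφ a hl.of_append_left,
        blockLength_listProd hφ hm.tail]
      simp only [List.length_append, List.length_cons]
      omega
  · left
    have hred : IsReducedList φ (l ++ ⟨i, g * φ i b⟩ :: ⟨j, h⟩ :: m) := by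
      refine ⟨?_, ?_⟩
      · intro s hs
        rcases List.mem_append.1 hs with hs | hs
        · exact hl.1 s (by simp [hs])
        · rcases List.mem_cons.1 hs with rfl | hs
          · exact mul_notMem_range_right b hg
          · exact hm.1 s hs
      · rw [List.map_append, List.map_cons, List.map_cons, List.isChain_append_cons_cons]
        exact ⟨by simpa using hl.2, hij, hm.2⟩
    have := blockLength_eq hφ a hred
    rw [blockLength_eq hφ a hl, blockLength_eq hφ b hm]
    refine Eq.trans (congrArg _ ?_) (this.trans ?_)
    · simp [of_apply_eq_base, mul_assoc]
    · simp only [List.length_append, List.length_cons, List.length_nil]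
      omega

theorem exists_first_letter (hφ : ∀ i, Function.Injective (φ i))
    {v : PushoutI φ} {q : ℕ} (hv : blockLength φ v = q + 1) :
    ∃ (i : ι) (g : K i) (v₁ : PushoutI φ), v = of i g * v₁ ∧ g ∉ (φ i).range ∧
      blockLength φ v₁ = q := by
  obtain ⟨a, l, hl, rfl⟩ := exists_reduced_expression v
  rw [blockLength_eq hφ a hl] at hv
  rcases l with _ | ⟨⟨i, g⟩, l⟩
  · simp at hv
  refine ⟨i, φ i a * g, listProd φ l, ?_, mul_notMem_range_left a (hl.1 ⟨i, g⟩ (by simp)), ?_⟩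
  · simp [of_apply_eq_base, mul_assoc]
  · rw [blockLength_listProd hφ hl.tail]
    simpa using hv

/-- If a letter extends an element, it extends its reduced expressions. -/
theorem exists_reduced_append (hφ : ∀ i, Function.Injective (φ i))
    {y : PushoutI φ} {i : ι} {g : K i}
    (hg : g ∉ (φ i).range) (h : blockLength φ (y * of i g) = blockLength φ y + 1) :
    ∃ a l, IsReducedList φ (l ++ [⟨i, g⟩]) ∧ base φ a * listProd φ l = y := by
  obtain ⟨a, l, hl, rfl⟩ := exists_reduced_expression y
  refine ⟨a, l, ⟨?_, ?_⟩, rfl⟩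
  · intro s hs
    rcases List.mem_append.1 hs with hs | hs
    · exact hl.1 s hs
    · rw [List.mem_singleton.1 hs]; exact hg
  rcases List.eq_nil_or_concat' l with rfl | ⟨l, ⟨j, x⟩, rfl⟩
  · simp
  rw [List.map_append, List.map_append, List.append_assoc]
  refine List.isChain_append_cons_cons.2 ⟨by simpa using hl.2, fun hji => ?_, by simp⟩
  dsimp only at hji
  subst hji
  -- If the last letter of `y` lay in the factor of `g`, the two would merge and the block length
  -- could not grow.
  rw [blockLength_eq hφ a hl] at h
  have h1 := blockLength_mul_le (base φ a * listProd φ l) (of j (x * g))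
  rw [blockLength_eq hφ a hl.of_append_left] at h1
  have h2 := blockLength_of_le (φ := φ) j (x * g)
  have h3 : base φ a * listProd φ (l ++ [⟨j, x⟩]) * of j g =
      base φ a * listProd φ l * of j (x * g) := by simp [mul_assoc]
  rw [h3] at h
  simp only [List.length_append, List.length_cons, List.length_nil] at h
  omega

/-- Write `y = y' g' g⁻¹`. If `g' g⁻¹` were outside the base group, appending it as one or two
letters to a reduced expression of `y'` would give `y` a larger block length than `y'`. -/
theorem last_letter_unique (hφ : ∀ i, Function.Injective (φ i))
    {y y' : PushoutI φ} {i j : ι} {g : K i} {g' : K j}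
    (hg : g ∉ (φ i).range) (hg' : g' ∉ (φ j).range)
    (hyy : blockLength φ y = blockLength φ y')
    (hy' : blockLength φ (y' * of j g') = blockLength φ y' + 1)
    (h : y * of i g = y' * of j g') : of j g' * (of i g)⁻¹ ∈ (base φ).range := by
  obtain ⟨a, l, hl, rfl⟩ := exists_reduced_append hφ hg' hy'
  have hy : y = base φ a * listProd φ l * of j g' * (of i g)⁻¹ := by rw [← h]; group
  rw [blockLength_eq hφ a hl.of_append_left] at hyy
  by_cases hij : i = j
  · subst hij
    rw [← map_inv, ← map_mul]
    by_cases hr : g' * g⁻¹ ∈ (φ i).range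
    · obtain ⟨b, hb⟩ := hr
      exact ⟨b, by rw [← hb, of_apply_eq_base]⟩
    · have hred : IsReducedList φ (l ++ [⟨i, g' * g⁻¹⟩]) := by
        refine ⟨?_, by simpa using hl.2⟩
        intro s hs
        rcases List.mem_append.1 hs with hs | hs
        · exact hl.1 s (by simp [hs])
        · rw [List.mem_singleton.1 hs]; exact hr
      have := blockLength_eq hφ a hred
      have h3 : base φ a * listProd φ (l ++ [⟨i, g' * g⁻¹⟩]) = y := by
        rw [hy]; simp [mul_assoc]
      rw [h3, hyy] at this
      simp at this
  · have hred : IsReducedList φ (l ++ [⟨j, g'⟩, ⟨i, g⁻¹⟩]) := by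
      refine ⟨?_, ?_⟩
      · intro s hs
        rcases List.mem_append.1 hs with hs | hs
        · exact hl.1 s (by simp [hs])
        · rcases List.mem_cons.1 hs with rfl | hs
          · exact hg'
          · rw [List.mem_singleton.1 hs]
            exact fun h => hg (inv_mem_iff.1 h)
      · rw [List.map_append]
        exact List.isChain_append_cons_cons.2 ⟨by simpa using hl.2, Ne.symm hij, by simp⟩
    have := blockLength_eq hφ a hred
    have h3 : base φ a * listProd φ (l ++ [⟨j, g'⟩, ⟨i, g⁻¹⟩]) = y := by
      rw [hy]; simp [mul_assoc]
    rw [h3, hyy] at this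
    simp at this

/-- Suffixes of a given block length are unique up to the base group. -/
theorem suffix_unique (hφ : ∀ i, Function.Injective (φ i))
    {y y' v v' : PushoutI φ} (h : y * v = y' * v')
    (hv : blockLength φ v = blockLength φ v')
    (hyv : blockLength φ (y * v) = blockLength φ y + blockLength φ v)
    (hyv' : blockLength φ (y' * v') = blockLength φ y' + blockLength φ v') :
    v' * v⁻¹ ∈ (base φ).range := by
  induction hq : blockLength φ v generalizing y y' v v' with
  | zero =>
    exact mul_mem (blockLength_eq_zero hφ (by omega))
      (inv_mem (blockLength_eq_zero hφ hq))
  | succ q ih =>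
    obtain ⟨i, g, v₁, rfl, hg, hv₁⟩ := exists_first_letter hφ hq
    obtain ⟨j, g', v₁', rfl, hg', hv₁'⟩ := exists_first_letter hφ (hv ▸ hq)
    have e1 := blockLength_mul_le (y * of i g) v₁
    have e2 := blockLength_mul_le (y' * of j g') v₁'
    have e3 := blockLength_mul_le y (of i g)
    have e4 := blockLength_mul_le y' (of j g')
    have e5 := blockLength_of_le (φ := φ) i g
    have e6 := blockLength_of_le (φ := φ) j g'
    rw [← mul_assoc] at h hyv hyv'
    rw [← mul_assoc] at h
    have hyy : blockLength φ y = blockLength φ y' := by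
      have := congrArg (blockLength φ) h
      omega
    -- The first letters of the suffixes are moved to the prefixes. The shorter suffixes then differ
    -- by some `b` in the base group, which is pushed back into `g'` before the last letters are
    -- compared.
    obtain ⟨b, hb⟩ := ih h (by omega) (by omega) (by omega) hv₁
    have hv' : v₁' = base φ b * v₁ := by rw [hb]; group
    subst hv'
    have h' : y * of i g = y' * of j (g' * φ j b) := by
      rw [map_mul, of_apply_eq_base]
      rw [← mul_assoc] at h
      have := mul_right_cancel h
      rw [this, mul_assoc]
    have hlast := last_letter_unique hφ hg (mul_notMem_range_right b hg') hyy (by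
      rw [map_mul, of_apply_eq_base, ← mul_assoc, blockLength_mul_base]; omega) h'
    rw [map_mul, of_apply_eq_base] at hlast
    have : of j g' * (base φ b * v₁) * (of i g * v₁)⁻¹ =
        of j g' * base φ b * (of i g)⁻¹ := by group
    rwa [this]

/-! ### Exactness of the word length on reduced products and on the factors. -/

section Exact

variable {ℓ₀ : A → ℕ} {ℓ : (Σ i, K i) → ℕ}

/-- The word length splits along a reduced product, up to the base group. -/
theorem wordLength_split (hφ : ∀ i, Function.Injective (φ i))
    (hℓ : IsLetterLength φ ℓ₀ ℓ) {y v : PushoutI φ}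
    (h : blockLength φ (y * v) = blockLength φ y + blockLength φ v) :
    ∃ b : A, wordLength φ ℓ₀ ℓ (y * base φ b) + wordLength φ ℓ₀ ℓ (base φ b⁻¹ * v) ≤
      wordLength φ ℓ₀ ℓ (y * v) := by
  obtain ⟨a, l, hl, hk, hlen⟩ := exists_wordLength_eq ℓ₀ ℓ (y * v)
  have hbl := blockLength_eq hφ a hl
  rw [hk, h] at hbl
  -- A length-minimising expression is cut where `v` should begin; by `suffix_unique` the tail is
  -- `v` up to the element `b` of the base group.
  obtain ⟨l₁, l₂, rfl, h₂⟩ : ∃ l₁ l₂, l = l₁ ++ l₂ ∧ l₂.length = blockLength φ v :=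
    ⟨l.take (blockLength φ y), l.drop (blockLength φ y), by simp, by
      rw [List.length_drop]; omega⟩
  have hl₁ := hl.of_append_left
  have hl₂ := hl.of_append_right
  have hb₂ := blockLength_listProd hφ hl₂
  rw [listProd_append, ← mul_assoc] at hk
  obtain ⟨b, hb⟩ := suffix_unique hφ hk (by omega)
    (by rw [hk, h, hb₂, blockLength_eq hφ a hl₁]; simp only [List.length_append] at hbl; omega) h
  have hv : base φ b⁻¹ * v = listProd φ l₂ := by rw [map_inv, hb]; group
  have hy : y * base φ b = base φ a * listProd φ l₁ := by
    have : y = base φ a * listProd φ l₁ * listProd φ l₂ * v⁻¹ := by rw [hk]; group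
    rw [hb, this]; group
  refine ⟨b, ?_⟩
  rw [hv, hy, hlen]
  have h1 := wordLength_le (ℓ₀ := ℓ₀) (ℓ := ℓ) a hl₁
  have h2 := wordLength_le (ℓ₀ := ℓ₀) (ℓ := ℓ) 1 hl₂
  rw [map_one, one_mul, hℓ.base_one] at h2
  rw [List.map_append, List.sum_append]
  omega

theorem le_wordLength_base (hφ : ∀ i, Function.Injective (φ i))
    (a : A) : ℓ₀ a ≤ wordLength φ ℓ₀ ℓ (base φ a) := by
  obtain ⟨b, l, hl, hk, hlen⟩ := exists_wordLength_eq ℓ₀ ℓ (base φ a)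
  have hbl := blockLength_eq hφ b hl
  rw [hk, blockLength_base, eq_comm, List.length_eq_zero_iff] at hbl
  subst hbl
  rw [listProd_nil, mul_one] at hk
  rw [hlen, base_injective hφ hk]
  simp

/-- A minimal expression of an element of a factor has at most one letter, and that letter lies in
the same factor since distinct factors meet in the base group. This turns length estimates in the
amalgam into estimates in the factor. -/
theorem le_wordLength_of (hφ : ∀ i, Function.Injective (φ i))
    (hℓ : IsLetterLength φ ℓ₀ ℓ) (i : ι) (x : K i) :
    ℓ ⟨i, x⟩ ≤ wordLength φ ℓ₀ ℓ (of i x) := by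
  obtain ⟨b, l, hl, hk, hlen⟩ := exists_wordLength_eq ℓ₀ ℓ (of (φ := φ) i x)
  have hbl := blockLength_eq hφ b hl
  have hle := blockLength_of_le (φ := φ) i x
  rw [hk] at hbl
  rw [hlen]
  rcases l with _ | ⟨⟨j, y⟩, l⟩
  · rw [listProd_nil, mul_one, ← of_apply_eq_base φ i] at hk
    rw [← of_injective hφ i hk, hℓ.compat]
    simp
  · obtain rfl : l = [] := by
      rw [← List.length_eq_zero_iff]
      simp only [List.length_cons] at hbl
      omega
    rw [listProd_cons, listProd_nil, mul_one, ← of_apply_eq_base φ j, ← map_mul] at hk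
    by_cases hij : i = j
    · subst hij
      rw [← of_injective hφ i hk, ← hℓ.compat i]
      simpa using hℓ.mul i (φ i b) y
    · exfalso
      have hmem : of i x ∈ (base φ).range := by
        rw [← inf_of_range_eq_base_range hφ hij]
        exact ⟨⟨x, rfl⟩, ⟨_, hk⟩⟩
      obtain ⟨c, hc⟩ := hmem
      rw [← hc, blockLength_base] at hbl
      simp at hbl

end Exact

end Words

/-! ### Decomposition of products by cancellation, and the bound on each class. -/

/-- Coset representatives of minimal length. -/
theorem exists_minimal_transversal {Γ : Type*} [Group Γ] (M : Subgroup Γ) (L : Γ → ℕ) :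
    ∃ U : Set Γ, (∀ g, ∃ u ∈ U, u⁻¹ * g ∈ M) ∧ (∀ u ∈ U, ∀ u' ∈ U, u⁻¹ * u' ∈ M → u = u') ∧
      ∀ u ∈ U, ∀ m ∈ M, L u ≤ L (u * m) := by
  have h : ∀ x : Γ ⧸ M, ∃ g : Γ, (g : Γ ⧸ M) = x ∧ ∀ g' : Γ, (g' : Γ ⧸ M) = x → L g ≤ L g' := by
    intro x
    have hne : {n | ∃ g : Γ, (g : Γ ⧸ M) = x ∧ L g = n}.Nonempty := by
      obtain ⟨g, rfl⟩ := QuotientGroup.mk_surjective x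
      exact ⟨_, g, rfl, rfl⟩
    obtain ⟨g, hg, hL⟩ := Nat.sInf_mem hne
    exact ⟨g, hg, fun g' hg' => hL ▸ Nat.sInf_le ⟨g', hg', rfl⟩⟩
  choose ρ hρ hmin using h
  refine ⟨Set.range ρ, fun g => ⟨ρ g, ⟨_, rfl⟩, ?_⟩, ?_, ?_⟩
  · rw [← QuotientGroup.eq, hρ]
  · rintro _ ⟨x, rfl⟩ _ ⟨x', rfl⟩ h
    rw [← QuotientGroup.eq, hρ, hρ] at h
    rw [h]
  · rintro _ ⟨x, rfl⟩ m hm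
    refine hmin x _ ?_
    rw [QuotientGroup.mk_mul_of_mem _ hm, hρ]

section Blocks

variable {ι : Type*} {K : ι → Type*} {A : Type*} [∀ i, Group (K i)] [Group A]
  {φ : ∀ i, A →* K i}

/-- The pairs `(y, z)` for which a suffix of `y` of block length `q` cancels in `y z`, leaving a
prefix of block length `p`, and a letter of block length `ε` is absorbed. -/
def blockSet {E : Type*} [Group E] (κ : E →* PushoutI φ) (ε p q : ℕ) :
    Set (PushoutI φ × PushoutI φ) :=
  {x | ∃ (y v z : PushoutI φ) (t : E), x.1 = y * v ∧ x.2 = v⁻¹ * (κ t * z) ∧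
    blockLength φ y = p ∧ blockLength φ v = q ∧ blockLength φ x.1 = p + q ∧
    blockLength φ (κ t) = ε ∧ blockLength φ (κ t * z) = ε + blockLength φ z ∧
    blockLength φ x.2 = q + (ε + blockLength φ z) ∧
    blockLength φ (y * κ t) = p ∧ blockLength φ (y * κ t * z) = p + blockLength φ z}

/-- The inductive step of cancellation: as `h = g⁻¹ a`, the cancelled suffix `v` grows to `v g`
while `y`, `t` and `z` are unchanged. -/
theorem blockSet_extend {E : Type*} [Group E] {κ : E →* PushoutI φ} {ε p q : ℕ}
    {y₁ z₁ : PushoutI φ} {a : A} {i : ι} {g h : K i}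
    (hB : (y₁, base φ a * z₁) ∈ blockSet κ ε p q) (hgh : φ i a = g * h)
    (hy : blockLength φ (y₁ * of i g) = blockLength φ y₁ + 1)
    (hz : blockLength φ (of i h * z₁) = blockLength φ z₁ + 1) :
    (y₁ * of i g, of i h * z₁) ∈ blockSet κ ε p (q + 1) := by
  obtain ⟨y, v, z, t, h1, h2, h3, h4, h5, h6, h7, h8, h9, h10⟩ := hB
  dsimp only at h1 h2 h5 h8
  have e0 : y₁ * of i g = y * (v * of i g) := by rw [h1, mul_assoc]
  have e1 := blockLength_mul_le y (v * of i g)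
  have e2 := blockLength_mul_le v (of i g)
  have e3 := blockLength_of_le (φ := φ) i g
  rw [blockLength_base_mul] at h8
  rw [← e0] at e1
  refine ⟨y, v * of i g, z, t, e0, ?_, h3, by omega, by dsimp only; omega, h6, h7,
    by dsimp only; omega, h9, h10⟩
  have e4 : of i h = (of i g)⁻¹ * base φ a := by
    rw [← of_apply_eq_base φ i, hgh, map_mul, inv_mul_cancel_left]
  dsimp only
  rw [e4, mul_assoc, h2, mul_inv_rev, mul_assoc]

/-- Cancel letters at the junction for as long as adjacent ones multiply into the base group. The
process stops either with a product without merging or with a merged letter; in the latter case the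
prefix keeps at least that letter, hence `p + 1`. -/
theorem mem_blockSet (hφ : ∀ i, Function.Injective (φ i)) (y z : PushoutI φ) :
    (∃ p q, p + q = blockLength φ y ∧ (y, z) ∈ blockSet (base φ) 0 p q) ∨
    ∃ i p q, p + 1 + q = blockLength φ y ∧ (y, z) ∈ blockSet (of (φ := φ) i) 1 (p + 1) q := by
  have h1 : blockLength φ 1 = 0 := by simpa using blockLength_base (φ := φ) 1
  induction hn : blockLength φ y generalizing y z with
  | zero =>
    left
    obtain ⟨a, rfl⟩ := blockLength_eq_zero hφ hn
    exact ⟨0, 0, rfl, base φ a, 1, z, 1, by simp, by simp, hn, h1, hn, by simp [h1], by simp,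
      by simp, by simpa using hn, by simp [blockLength_base_mul]⟩
  | succ n ih =>
    rcases blockLength_mul_cases hφ y z with hadd |
      ⟨i, g, h, y₁, z₁, rfl, rfl, hg, hh, hy, hz, hgh⟩
    · left
      exact ⟨n + 1, 0, rfl, y, 1, z, 1, by simp, by simp, hn, h1, hn, by simp [h1], by simp,
        by simp, by simpa using hn, by simpa [hn] using hadd⟩
    by_cases hr : g * h ∈ (φ i).range
    · obtain ⟨a, ha⟩ := hr
      rcases ih y₁ (base φ a * z₁) (by omega) with ⟨p, q, hpq, hB⟩ | ⟨j, p, q, hpq, hB⟩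
      · exact Or.inl ⟨p, q + 1, by omega, blockSet_extend hB ha hy hz⟩
      · exact Or.inr ⟨j, p, q + 1, by omega, blockSet_extend hB ha hy hz⟩
    · right
      have h2 := hgh hr
      have h3 := blockLength_mul_le (y₁ * of i (g * h)) z₁
      have h4 := blockLength_mul_le y₁ (of i (g * h))
      have h5 := blockLength_of_le (φ := φ) i (g * h)
      have h6 := blockLength_of hφ hh
      rw [map_mul] at h2 h3 h4 h5
      refine ⟨i, n, 0, by omega, y₁ * of i g, 1, z₁, h, by simp, by simp, hn, h1, hn, h6,
        by omega, by dsimp only; omega, ?_, ?_⟩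
      · rw [mul_assoc]; omega
      · rw [mul_assoc y₁]; omega

variable {ℓ₀ : A → ℕ} {ℓ : (Σ i, K i) → ℕ}

/-- The trilinear form restricted to a block set. -/
theorem tsum_blockSet_le (hφ : ∀ i, Function.Injective (φ i)) (hℓ : IsLetterLength φ ℓ₀ ℓ)
    {E : Type*} [Group E] (κ : E →* PushoutI φ) (hκ : Function.Injective κ)
    (hA : (base φ).range ≤ κ.range) (ℓE : E → ℕ)
    (hℓE : ∀ s, ℓE s ≤ wordLength φ ℓ₀ ℓ (κ s)) {n : ℕ} {c : ℝ≥0∞}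
    (hc : TrilinearBound {s | ℓE s ≤ 2 * n} c) (ε p q : ℕ) (f ψ χ : PushoutI φ → ℝ≥0∞)
    (hf : ∀ k, f k ≠ 0 → wordLength φ ℓ₀ ℓ k ≤ n) :
    ∑' x : blockSet κ ε p q, f x.1.1 * ψ x.1.2 * χ (x.1.1 * x.1.2) ≤
      c * (sqSum f ^ (1 / 2 : ℝ) * sqSum ψ ^ (1 / 2 : ℝ) * sqSum χ ^ (1 / 2 : ℝ)) := by
  obtain ⟨U, hU, hUu, hUm⟩ := exists_minimal_transversal κ.range (wordLength φ ℓ₀ ℓ)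
  obtain ⟨V', hV', hVu', hVm'⟩ := exists_minimal_transversal (base φ).range (wordLength φ ℓ₀ ℓ)
  -- Suffixes are determined up to left multiplication by the base group, so representatives of
  -- right cosets are needed; they are inverses of representatives of left cosets.
  let V : Set (PushoutI φ) := {v | v⁻¹ ∈ V'}
  have hV : ∀ g, ∃ v ∈ V, ∃ a, g = base φ a * v := by
    intro g
    obtain ⟨u, hu, a, ha⟩ := hV' g⁻¹
    refine ⟨u⁻¹, by simpa [V] using hu, a⁻¹, ?_⟩
    rw [map_inv, ha]; group
  have hVu : ∀ v ∈ V, ∀ v' ∈ V, v' * v⁻¹ ∈ (base φ).range → v = v' := by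
    intro v hv v' hv' h
    exact inv_injective (hVu' _ hv' _ hv (by simpa using h)).symm
  have hVm : ∀ v ∈ V, ∀ a, wordLength φ ℓ₀ ℓ v ≤ wordLength φ ℓ₀ ℓ (base φ a * v) := by
    intro v hv a
    rw [← wordLength_inv hℓ v, ← wordLength_inv hℓ (base φ a * v), mul_inv_rev, ← map_inv]
    exact hVm' _ hv _ ⟨_, rfl⟩
  have hUκ : ∀ u ∈ U, ∀ u' ∈ U, ∀ s s', u * κ s = u' * κ s' → u = u' ∧ s = s' := by
    intro u hu u' hu' s s' h
    have : u = u' := hUu u hu u' hu' ⟨s * s'⁻¹, by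
      rw [map_mul, map_inv, eq_inv_mul_iff_mul_eq, ← mul_assoc, h]; group⟩
    subst this
    exact ⟨rfl, hκ (mul_left_cancel h)⟩
  -- These conditions record the block lengths that make `suffix_unique` applicable to each of the
  -- three factorisations.
  let P : PushoutI φ → E → PushoutI φ → Prop := fun u s v =>
    blockLength φ (u * κ s) = p ∧ blockLength φ v = q ∧ blockLength φ (u * κ s * v) = p + q
  let Q : PushoutI φ → E → PushoutI φ → Prop := fun v t w =>
    blockLength φ v = q ∧ blockLength φ (κ t) = ε ∧
    blockLength φ (κ t * w) = ε + blockLength φ w ∧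
    blockLength φ (v⁻¹ * κ t * w) = q + (ε + blockLength φ w)
  let R : PushoutI φ → E → PushoutI φ → Prop := fun u r w =>
    blockLength φ (u * κ r) = p ∧ blockLength φ (u * κ r * w) = p + blockLength φ w
  refine le_trans ?_ (hc.tsum_blocks_le κ U V V P Q R f ψ χ ?_ ?_ ?_ ?_)
  · let F : {x : (U × V × V) × E × E // P x.1.1 x.2.1 x.1.2.1 ∧ Q x.1.2.1 x.2.2 x.1.2.2 ∧
        R x.1.1 (x.2.1 * x.2.2) x.1.2.2} → PushoutI φ × PushoutI φ :=
      fun x => (x.1.1.1 * κ x.1.2.1 * x.1.1.2.1, (x.1.1.2.1 : PushoutI φ)⁻¹ * κ x.1.2.2 * x.1.1.2.2)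
    have hF : ∀ x : blockSet κ ε p q, ∃ r, F r = x.1 := by
      rintro ⟨⟨y₀, z₀⟩, y, v, z, t, h1, h2, h3, h4, h5, h6, h7, h8, h9, h10⟩
      dsimp only at h1 h2 h5 h8
      obtain ⟨v, hv, a, rfl⟩ := hV v
      obtain ⟨w, hw, b, rfl⟩ := hV z
      obtain ⟨u, hu, s, hs⟩ := hU (y * base φ a)
      -- Replacing `v` and `z` by their representatives leaves factors `a` and `b` of the base
      -- group, which are absorbed into the middle letters.
      obtain ⟨t', ht'⟩ : ∃ t', κ t' = base φ a⁻¹ * κ t * base φ b :=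
        mul_mem (mul_mem (hA ⟨_, rfl⟩) ⟨t, rfl⟩) (hA ⟨_, rfl⟩)
      have hus : u * κ s = y * base φ a := by rw [hs]; group
      have e1 : u * κ s * v = y₀ := by rw [hus, h1]; group
      have e2 : κ t' * w = base φ a⁻¹ * (κ t * (base φ b * w)) := by rw [ht']; group
      have e3 : v⁻¹ * κ t' * w = z₀ := by rw [mul_assoc, e2, h2, map_inv]; group
      have e4 : u * κ (s * t') = y * κ t * base φ b := by
        rw [map_mul, ← mul_assoc, hus, ht', map_inv]; group
      have e5 : u * κ (s * t') * w = y * κ t * (base φ b * w) := by rw [e4]; group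
      rw [blockLength_base_mul] at h4 h7 h8 h10
      refine ⟨⟨((⟨u, hu⟩, ⟨v, hv⟩, ⟨w, hw⟩), s, t'), ⟨?_, h4, ?_⟩, ⟨h4, ?_, ?_, ?_⟩, ?_, ?_⟩, ?_⟩
      · rw [hus, blockLength_mul_base, h3]
      · exact (congrArg _ e1).trans h5
      · rw [ht', blockLength_mul_base, blockLength_base_mul, h6]
      · rw [e2, blockLength_base_mul, h7]
      · exact (congrArg _ e3).trans h8
      · exact (congrArg _ e4).trans ((blockLength_mul_base _ _).trans h9)
      · exact (congrArg _ e5).trans h10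
      · exact Prod.ext e1 e3
    choose r hr using hF
    have hinj : Function.Injective r := fun x x' h => Subtype.ext (by rw [← hr, h, hr])
    refine le_trans (le_of_eq (tsum_congr fun x => ?_))
      (ENNReal.tsum_comp_le_tsum_of_injective hinj _)
    have h1 := congrArg Prod.fst (hr x)
    have h2 := congrArg Prod.snd (hr x)
    simp only [F] at h1 h2
    rw [h1, h2]
    congr 2
    rw [← h1, ← h2, map_mul]
    group
  · rintro u hu v hv s ⟨h1, h2, h3⟩ hne
    have hLn := hf _ hne
    -- Minimality of `u` and `v` in their cosets gives `L(u) + L(v) ≤ L(usv) ≤ n`, and then `L(s) ≤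
    -- L(u) + L(usv) + L(v) ≤ 2n`.
    obtain ⟨b, hb⟩ := wordLength_split hφ hℓ (y := u * κ s) (v := v) (by omega)
    have hu' : wordLength φ ℓ₀ ℓ u ≤ wordLength φ ℓ₀ ℓ (u * κ s * base φ b) := by
      rw [mul_assoc]
      exact hUm u hu _ (mul_mem ⟨s, rfl⟩ (hA ⟨b, rfl⟩))
    have hv' := hVm v hv b⁻¹
    have hs : κ s = u⁻¹ * (u * κ s * v) * v⁻¹ := by group
    have e1 := wordLength_mul_le hℓ (u⁻¹ * (u * κ s * v)) v⁻¹
    have e2 := wordLength_mul_le hℓ u⁻¹ (u * κ s * v)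
    rw [← hs, wordLength_inv hℓ] at e1
    rw [wordLength_inv hℓ] at e2
    have := hℓE s
    show ℓE s ≤ 2 * n
    omega
  · rintro u hu u' hu' v hv v' hv' s s' ⟨h1, h2, h3⟩ ⟨h1', h2', h3'⟩ h
    have hvv := hVu v hv v' hv'
      (suffix_unique hφ h (by omega) (by omega) (by omega))
    subst hvv
    obtain ⟨h4, h5⟩ := hUκ u hu u' hu' s s' (mul_right_cancel h)
    exact ⟨h4, h5, rfl⟩
  · rintro v hv v' hv' w hw w' hw' t t' ⟨h1, h2, h3, h4⟩ ⟨h1', h2', h3', h4'⟩ h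
    -- Inversion turns the prefix `v⁻¹` into the suffix `v`, to which `suffix_unique` applies.
    have hinv : (κ t * w)⁻¹ * v = (κ t' * w')⁻¹ * v' := by
      have := congrArg (·⁻¹) h
      simpa [mul_assoc] using this
    have e1 : blockLength φ ((κ t * w)⁻¹ * v) = q + (ε + blockLength φ w) := by
      rw [← h4, ← blockLength_inv]; congr 1; group
    have e1' : blockLength φ ((κ t' * w')⁻¹ * v') = q + (ε + blockLength φ w') := by
      rw [← h4', ← blockLength_inv]; congr 1; group
    have hvv := hVu v hv v' hv' (suffix_unique hφ hinv (by omega)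
      (by rw [e1, blockLength_inv]; omega) (by rw [e1', blockLength_inv]; omega))
    subst hvv
    have htw : κ t * w = κ t' * w' := by
      rw [mul_assoc, mul_assoc] at h
      exact mul_left_cancel h
    have e2 := congrArg (blockLength φ) htw
    have hww := hVu w hw w' hw' (suffix_unique hφ htw (by omega) (by omega) (by omega))
    subst hww
    exact ⟨rfl, hκ (mul_right_cancel htw), rfl⟩
  · rintro u hu u' hu' w hw w' hw' s s' ⟨h1, h2⟩ ⟨h1', h2'⟩ h
    have e2 := congrArg (blockLength φ) h
    have hww := hVu w hw w' hw' (suffix_unique hφ h (by omega) (by omega) (by omega))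
    subst hww
    obtain ⟨h4, h5⟩ := hUκ u hu u' hu' s s' (mul_right_cancel h)
    exact ⟨h4, h5, rfl⟩

theorem blockLength_le_wordLength (hφ : ∀ i, Function.Injective (φ i))
    (hpos : ∀ i (x : K i), x ∉ (φ i).range → ℓ ⟨i, x⟩ ≠ 0) (k : PushoutI φ) :
    blockLength φ k ≤ wordLength φ ℓ₀ ℓ k := by
  obtain ⟨a, l, hl, rfl, h⟩ := exists_wordLength_eq ℓ₀ ℓ k
  rw [h, blockLength_eq hφ a hl]
  have : l.length ≤ (l.map ℓ).sum := by
    have := List.length_le_sum_of_one_le (l.map ℓ) (by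
      intro m hm
      obtain ⟨s, hs, rfl⟩ := List.mem_map.1 hm
      exact Nat.one_le_iff_ne_zero.2 (hpos s.1 s.2 (hl.1 s hs)))
    simpa using this
  omega

/-- The trilinear bound on an amalgamated product. -/
theorem trilinearBound_pushout [Fintype ι] (hφ : ∀ i, Function.Injective (φ i))
    (hℓ : IsLetterLength φ ℓ₀ ℓ) (hpos : ∀ i (x : K i), x ∉ (φ i).range → ℓ ⟨i, x⟩ ≠ 0)
    {n : ℕ} {c : ℝ≥0∞} (hc₀ : TrilinearBound {a | ℓ₀ a ≤ 2 * n} c)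
    (hc : ∀ i, TrilinearBound {x : K i | ℓ ⟨i, x⟩ ≤ 2 * n} c) :
    TrilinearBound {k : PushoutI φ | wordLength φ ℓ₀ ℓ k ≤ n}
      (((n + 1) ^ 2 + Fintype.card ι * n ^ 2 : ℕ) * c) := by
  intro f ψ χ hf
  -- Without a merged letter `p + q ≤ n`; with one, `p + 1 + q ≤ n`, so both indices are below `n`.
  -- The classes need only cover, since all terms are nonnegative.
  let C : (Fin (n + 1) × Fin (n + 1)) ⊕ (ι × Fin n × Fin n) → Set (PushoutI φ × PushoutI φ)
    | Sum.inl x => blockSet (base φ) 0 x.1 x.2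
    | Sum.inr x => blockSet (of (φ := φ) x.1) 1 (x.2.1 + 1) x.2.2
  let F : PushoutI φ × PushoutI φ → ℝ≥0∞ := fun x => f x.1 * ψ x.2 * χ (x.1 * x.2)
  have hsupp : Function.support F ⊆ ⋃ r, C r := by
    rintro ⟨y, z⟩ hF
    have hy : f y ≠ 0 := by
      intro h0
      exact hF (by simp [F, h0])
    have hn : blockLength φ y ≤ n := (blockLength_le_wordLength hφ hpos y).trans (hf y hy)
    rw [Set.mem_iUnion]
    rcases mem_blockSet hφ y z with ⟨p, q, hpq, h⟩ | ⟨i, p, q, hpq, h⟩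
    · exact ⟨Sum.inl (⟨p, by omega⟩, ⟨q, by omega⟩), h⟩
    · exact ⟨Sum.inr (i, ⟨p, by omega⟩, ⟨q, by omega⟩), h⟩
  calc trilinear f ψ χ = ∑' x, F x := by
        unfold trilinear
        rw [ENNReal.tsum_prod (f := fun y z => f y * ψ z * χ (y * z))]
    _ = ∑' x : ⋃ r, C r, F x := (tsum_subtype_eq_of_support_subset hsupp).symm
    _ ≤ ∑ r, ∑' x : C r, F x := ENNReal.tsum_iUnion_le F C
    _ ≤ ∑ r : (Fin (n + 1) × Fin (n + 1)) ⊕ (ι × Fin n × Fin n),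
          c * (sqSum f ^ (1 / 2 : ℝ) * sqSum ψ ^ (1 / 2 : ℝ) * sqSum χ ^ (1 / 2 : ℝ)) := by
        refine Finset.sum_le_sum fun r _ => ?_
        rcases r with x | x
        · exact tsum_blockSet_le hφ hℓ (base φ) (base_injective hφ) le_rfl ℓ₀
            (le_wordLength_base hφ) hc₀ _ _ _ f ψ χ hf
        · refine tsum_blockSet_le hφ hℓ (of x.1) (of_injective hφ x.1) ?_ (fun s => ℓ ⟨x.1, s⟩)
            (le_wordLength_of hφ hℓ x.1) (hc x.1) _ _ _ f ψ χ hf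
          rintro _ ⟨a, rfl⟩
          exact ⟨φ x.1 a, of_apply_eq_base φ x.1 a⟩
    _ = _ := by
        have hcard : (Finset.univ : Finset ((Fin (n + 1) × Fin (n + 1)) ⊕
            (ι × Fin n × Fin n))).card = (n + 1) ^ 2 + Fintype.card ι * n ^ 2 := by
          simp [Finset.card_univ, sq]
        rw [Finset.sum_const, nsmul_eq_mul, hcard, ← mul_assoc]

end Blocks

theorem TrilinearBound.mono {G : Type*} [Group G] {S S' : Set G} {c : ℝ≥0∞}
    (h : TrilinearBound S c) (hS : S' ⊆ S) : TrilinearBound S' c :=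
  fun φ ψ χ hφ => h φ ψ χ fun g hg => hS (hφ g hg)

theorem HasDecay.mono {G : Type*} [Group G] {l l' : G → ℝ} {f f' : ℕ → ℝ} (h : HasDecay l f)
    (hl : ∀ g, l g ≤ l' g) (hf : ∀ n, f n ≤ f' n) : HasDecay l' f' := by
  intro n x hx
  refine (h n x fun g hg => (hl g).trans (hx g hg)).trans ?_
  exact mul_le_mul_of_nonneg_right (hf n) (Real.sqrt_nonneg _)

/-! ### Two factors: decay, RD and SD for integer-valued lengths. -/

section Amalgam

variable {A : Type v} {G H : Type u} [Group A] [Group G] [Group H] {i : A →* G} {j : A →* H}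

theorem amalgamLength_eq_wordLength (i : A →* G) (j : A →* H) (LG : G → ℕ) (LH : H → ℕ)
    (k : Amalgam i j) :
    amalgamLength i j LG LH k =
      wordLength (factorMap i j) (fun a => LG (i a)) (letterLength LG LH) k := by
  have hprod : ∀ w : CoprodI.Word (Factor G H),
      ofCoprodI (φ := factorMap i j) w.prod = listProd (factorMap i j) w.toList := by
    intro w
    simp only [CoprodI.Word.prod, map_list_prod, List.map_map, listProd]
    congr 1
  unfold amalgamLength wordLength
  congr 1
  ext n
  constructor
  · rintro ⟨a, w, hw, hk, hn⟩
    exact ⟨a, w.toList, ⟨hw, by rw [List.isChain_map]; exact w.chain_ne⟩, by rw [← hprod, hk], hn⟩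
  · rintro ⟨a, l, hl, hk, hn⟩
    refine ⟨a, ⟨l, fun s hs h => hl.1 s hs (h ▸ one_mem _), ?_⟩, hl.1, ?_, hn⟩
    · have := hl.2
      rwa [List.isChain_map] at this
    · rw [hprod, hk]

theorem factorMap_injective (hi : Function.Injective i) (hj : Function.Injective j) (b : Bool) :
    Function.Injective (factorMap i j b) := by
  cases b
  · exact hi
  · exact hj

variable {LG : G → ℕ} {LH : H → ℕ}

theorem isLetterLength_factor (hG : IsLengthFunction (fun g => (LG g : ℝ)))
    (hH : IsLengthFunction (fun h => (LH h : ℝ))) (hA : ∀ a, LG (i a) = LH (j a)) :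
    IsLetterLength (factorMap i j) (fun a => LG (i a)) (letterLength LG LH) where
  base_one := by rw [map_one]; exact_mod_cast hG.map_one
  base_inv a := by rw [map_inv]; exact_mod_cast hG.map_inv (i a)
  base_mul a b := by rw [map_mul]; exact_mod_cast hG.map_mul_le (i a) (i b)
  compat b a := by
    cases b
    · rfl
    · exact (hA a).symm
  inv b x := by
    cases b
    · exact_mod_cast hG.map_inv x
    · exact_mod_cast hH.map_inv x
  mul b x y := by
    cases b
    · exact_mod_cast hG.map_mul_le x y
    · exact_mod_cast hH.map_mul_le x y

theorem amalgamLength_isLengthFunction (hG : IsLengthFunction (fun g => (LG g : ℝ)))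
    (hH : IsLengthFunction (fun h => (LH h : ℝ))) (hA : ∀ a, LG (i a) = LH (j a)) :
    IsLengthFunction (fun k => (amalgamLength i j LG LH k : ℝ)) := by
  simp only [amalgamLength_eq_wordLength]
  exact wordLength_isLengthFunction (isLetterLength_factor hG hH hA)

/-- The class count is `3n² + 2n + 1 ≤ (2n+1)²`, so exponent 2 already suffices. -/
theorem add_sq_le_rpow (n : ℕ) :
    (((n + 1) ^ 2 + 2 * n ^ 2 : ℕ) : ℝ) ≤ (2 * (n : ℝ) + 1) ^ (7 / 2 : ℝ) := by
  have hn : (0 : ℝ) ≤ n := Nat.cast_nonneg n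
  calc (((n + 1) ^ 2 + 2 * n ^ 2 : ℕ) : ℝ) ≤ (2 * (n : ℝ) + 1) ^ 2 := by
        push_cast; nlinarith
    _ = (2 * (n : ℝ) + 1) ^ (2 : ℝ) := (Real.rpow_two _).symm
    _ ≤ _ := Real.rpow_le_rpow_of_exponent_le (by linarith) (by norm_num)

theorem HasDecay.amalgam (hi : Function.Injective i) (hj : Function.Injective j)
    (hG : IsLengthFunction (fun g => (LG g : ℝ))) (hH : IsLengthFunction (fun h => (LH h : ℝ)))
    (hA : ∀ a, LG (i a) = LH (j a)) (hG0 : ∀ g, g ∉ i.range → LG g ≠ 0)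
    (hH0 : ∀ h, h ∉ j.range → LH h ≠ 0) {f : ℕ → ℝ}
    (hfG : HasDecay (fun g => (LG g : ℝ)) f) (hfH : HasDecay (fun h => (LH h : ℝ)) f) :
    HasDecay (fun k => (amalgamLength i j LG LH k : ℝ))
      (fun n => (2 * (n : ℝ) + 1) ^ (7 / 2 : ℝ) * f (2 * n)) := by
  intro n x hx
  have hf : 0 ≤ f (2 * n) := zero_le_one.trans (hfG.one_le hG _)
  have hbG := hfG.trilinearBound hG (2 * n)
  have hbH := hfH.trilinearBound hH (2 * n)
  have hb := trilinearBound_pushout (φ := factorMap i j) (n := n)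
    (factorMap_injective hi hj) (isLetterLength_factor hG hH hA)
    (by
      intro b y hy
      cases b
      · exact hG0 y hy
      · exact hH0 y hy)
    ((hbG.comap i hi).mono (fun a ha => Nat.cast_le (α := ℝ).2 ha))
    (by
      intro b
      cases b
      · exact hbG.mono (fun g hg => Nat.cast_le (α := ℝ).2 hg)
      · exact hbH.mono (fun g hg => Nat.cast_le (α := ℝ).2 hg))
  rw [Fintype.card_bool, ← ENNReal.ofReal_natCast, ← ENNReal.ofReal_mul (by positivity)] at hb
  refine (reducedNorm_le_of_trilinearBound (by positivity) hb x ?_).trans ?_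
  · intro g hg
    have := hx g hg
    simp only [amalgamLength_eq_wordLength] at this
    exact Nat.cast_le.1 this
  · exact mul_le_mul_of_nonneg_right (mul_le_mul_of_nonneg_right (add_sq_le_rpow n) hf)
      (Real.sqrt_nonneg _)

theorem HasRD.amalgam (hi : Function.Injective i) (hj : Function.Injective j)
    (hG : IsLengthFunction (fun g => (LG g : ℝ))) (hH : IsLengthFunction (fun h => (LH h : ℝ)))
    (hA : ∀ a, LG (i a) = LH (j a)) (hG0 : ∀ g, g ∉ i.range → LG g ≠ 0)
    (hH0 : ∀ h, h ∉ j.range → LH h ≠ 0)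
    (hrG : HasRD (fun g => (LG g : ℝ))) (hrH : HasRD (fun h => (LH h : ℝ))) :
    HasRD (fun k => (amalgamLength i j LG LH k : ℝ)) := by
  obtain ⟨P, hP⟩ := hrG
  obtain ⟨Q, hQ⟩ := hrH
  have hP1 := hP.one_le hG
  have hQ1 := hQ.one_le hH
  have h := HasDecay.amalgam hi hj hG hH hA hG0 hH0 (f := fun n => (P + Q).eval (n : ℝ))
    (hP.mono (fun _ => le_rfl) (fun n => by
      rw [Polynomial.eval_add]; linarith [hQ1 n]))
    (hQ.mono (fun _ => le_rfl) (fun n => by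
      rw [Polynomial.eval_add]; linarith [hP1 n]))
  -- The exponent `7/2` is raised to 4 to obtain a polynomial, which is harmless because `2n + 1 ≥
  -- 1`.
  refine ⟨(2 * Polynomial.X + 1) ^ 4 * (P + Q).comp (2 * Polynomial.X),
    h.mono (fun _ => le_rfl) fun n => ?_⟩
  have hn : (0 : ℝ) ≤ n := Nat.cast_nonneg n
  have hpos : 0 ≤ (P + Q).eval (2 * (n : ℝ)) := by
    have h1 := hP1 (2 * n)
    have h2 := hQ1 (2 * n)
    push_cast at h1 h2
    rw [Polynomial.eval_add]
    linarith
  simp only [Polynomial.eval_mul, Polynomial.eval_pow, Polynomial.eval_add, Polynomial.eval_comp,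
    Polynomial.eval_X, Polynomial.eval_one, Polynomial.eval_ofNat, Nat.cast_mul, Nat.cast_ofNat]
  rw [Polynomial.eval_add] at hpos
  refine mul_le_mul_of_nonneg_right ?_ hpos
  rw [← Real.rpow_natCast]
  exact Real.rpow_le_rpow_of_exponent_le (by linarith) (by norm_num)

theorem IsSubexponential.max {f g : ℕ → ℝ} (hf : IsSubexponential f) (hg : IsSubexponential g) :
    IsSubexponential (fun n => max (f n) (g n)) := by
  refine ⟨fun n => (hf.1 n).trans (le_max_left _ _), ?_⟩
  have h := hf.2.max hg.2
  rw [max_self] at h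
  refine h.congr fun n => ?_
  exact ((Real.monotoneOn_rpow_Ici_of_exponent_nonneg
    (by positivity : (0 : ℝ) ≤ 1 / (n : ℝ))).map_max (hf.1 n) (hg.1 n)).symm

theorem IsSubexponential.rpow_mul_comp_two_mul {f : ℕ → ℝ} (hf : IsSubexponential f) :
    IsSubexponential (fun n => (2 * (n : ℝ) + 1) ^ (7 / 2 : ℝ) * f (2 * n)) := by
  refine ⟨fun n => mul_nonneg (by positivity) (hf.1 _), ?_⟩
  have h2 : Tendsto (fun n : ℕ => 2 * n) atTop atTop :=
    tendsto_id.const_mul_atTop' two_pos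
  have h1 : Tendsto (fun n : ℕ => (f (2 * n) ^ (1 / ((2 * n : ℕ) : ℝ))) ^ 2) atTop (𝓝 1) := by
    simpa using (hf.2.comp h2).pow 2
  have h3 : Tendsto (fun n : ℕ => ((2 * (n : ℝ) + 1) ^ (1 / (1 * (n : ℝ) + 0))) ^ (7 / 2 : ℝ))
      atTop (𝓝 1) := by
    -- At `x = 2n + 1` the denominator `x/2 - 1/2` equals `n`, so this is `(2n+1)^(1/n) → 1`.
    have h4 := (tendsto_rpow_div_mul_add 1 (1 / 2) (-1 / 2) (by norm_num)).comp
      (tendsto_atTop_add_const_right atTop (1 : ℝ)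
        (tendsto_natCast_atTop_atTop.const_mul_atTop (two_pos (α := ℝ))))
    have h5 := h4.rpow_const (p := (7 / 2 : ℝ)) (Or.inl one_ne_zero)
    rw [Real.one_rpow] at h5
    refine h5.congr fun n => ?_
    simp only [Function.comp]
    congr 3
    ring
  have h := h3.mul h1
  rw [mul_one] at h
  refine h.congr fun n => ?_
  have hn : (0 : ℝ) ≤ 2 * (n : ℝ) + 1 := by positivity
  rw [Real.mul_rpow (by positivity) (hf.1 _), ← Real.rpow_mul hn, ← Real.rpow_mul hn,
    ← Real.rpow_natCast, ← Real.rpow_mul (hf.1 _)]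
  congr 2
  · ring
  · push_cast
    rcases eq_or_ne (n : ℝ) 0 with h0 | h0
    · simp [h0]
    · field_simp

theorem HasSD.amalgam (hi : Function.Injective i) (hj : Function.Injective j)
    (hG : IsLengthFunction (fun g => (LG g : ℝ))) (hH : IsLengthFunction (fun h => (LH h : ℝ)))
    (hA : ∀ a, LG (i a) = LH (j a)) (hG0 : ∀ g, g ∉ i.range → LG g ≠ 0)
    (hH0 : ∀ h, h ∉ j.range → LH h ≠ 0)
    (hsG : HasSD (fun g => (LG g : ℝ))) (hsH : HasSD (fun h => (LH h : ℝ))) :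
    HasSD (fun k => (amalgamLength i j LG LH k : ℝ)) := by
  obtain ⟨f, hf, hfG⟩ := hsG
  obtain ⟨g, hg, hgH⟩ := hsH
  exact ⟨_, (hf.max hg).rpow_mul_comp_two_mul, HasDecay.amalgam hi hj hG hH hA hG0 hH0
    (hfG.mono (fun _ => le_rfl) fun n => le_max_left _ _)
    (hgH.mono (fun _ => le_rfl) fun n => le_max_right _ _)⟩

end Amalgam

/-! ### Reduction of real-valued lengths to integer-valued ones. -/

open Classical in
/-- An integer-valued length dominating `l`, positive off the subgroup `B`. -/
noncomputable def integralLength {G : Type*} [Group G] (B : Subgroup G) (l : G → ℝ) (g : G) : ℕ :=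
  ⌈l g⌉₊ + if g ∈ B then 0 else 1

section Integral

variable {G : Type*} [Group G] (B : Subgroup G) {l : G → ℝ}

theorem integralLength_isLengthFunction (hl : IsLengthFunction l) :
    IsLengthFunction (fun g => (integralLength B l g : ℝ)) where
  nonneg _ := Nat.cast_nonneg _
  map_one := by simp [integralLength, hl.map_one]
  map_inv g := by by_cases hg : g ∈ B <;> simp [integralLength, hl.map_inv, hg]
  map_mul_le g h := by
    have h1 : ⌈l (g * h)⌉₊ ≤ ⌈l g⌉₊ + ⌈l h⌉₊ :=
      (Nat.ceil_le_ceil (hl.map_mul_le g h)).trans (Nat.ceil_add_le _ _)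
    have h2 : integralLength B l (g * h) ≤ integralLength B l g + integralLength B l h := by
      unfold integralLength
      by_cases hg : g ∈ B
      · rw [if_pos hg, B.mul_mem_cancel_left hg]
        omega
      · rw [if_neg hg]
        split_ifs <;> omega
    exact_mod_cast h2

theorem le_integralLength (g : G) : l g ≤ integralLength B l g := by
  refine (Nat.le_ceil (l g)).trans ?_
  exact_mod_cast Nat.le_add_right _ _

theorem integralLength_ne_zero {g : G} (hg : g ∉ B) : integralLength B l g ≠ 0 := by
  simp [integralLength, hg]

theorem integralLength_of_mem {g : G} (hg : g ∈ B) : integralLength B l g = ⌈l g⌉₊ := by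
  simp [integralLength, hg]

/-- A larger length has smaller balls, so the same decay function works. -/
theorem HasRD.integralLength (h : HasRD l) : HasRD (fun g => (integralLength B l g : ℝ)) :=
  h.imp fun _ hP => hP.mono (le_integralLength B) fun _ => le_rfl

theorem HasSD.integralLength (h : HasSD l) : HasSD (fun g => (integralLength B l g : ℝ)) :=
  h.imp fun _ hf => ⟨hf.1, hf.2.mono (le_integralLength B) fun _ => le_rfl⟩

end Integral

theorem mainTheorem1 {A : Type v} {G H : Type u} [Group A] [Group G] [Group H]
    (i : A →* G) (j : A →* H) (hi : Function.Injective i) (hj : Function.Injective j) :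
    -- integer-valued lengths, nonzero off `A`: decay with respect to the explicit length
    (∀ (LG : G → ℕ) (LH : H → ℕ),
      IsLengthFunction (fun g => (LG g : ℝ)) → IsLengthFunction (fun h => (LH h : ℝ)) →
      (∀ a, LG (i a) = LH (j a)) →
      (∀ g, g ∉ i.range → LG g ≠ 0) → (∀ h, h ∉ j.range → LH h ≠ 0) →
      IsLengthFunction (fun k => (amalgamLength i j LG LH k : ℝ)) ∧
      (HasRD (fun g => (LG g : ℝ)) → HasRD (fun h => (LH h : ℝ)) →
        HasRD (fun k => (amalgamLength i j LG LH k : ℝ))) ∧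
      (HasSD (fun g => (LG g : ℝ)) → HasSD (fun h => (LH h : ℝ)) →
        HasSD (fun k => (amalgamLength i j LG LH k : ℝ))) ∧
      (∀ f : ℕ → ℝ, HasDecay (fun g => (LG g : ℝ)) f → HasDecay (fun h => (LH h : ℝ)) f →
        HasDecay (fun k => (amalgamLength i j LG LH k : ℝ))
          (fun n => (2 * (n : ℝ) + 1) ^ (7 / 2 : ℝ) * f (2 * n)))) ∧
    -- arbitrary real-valued lengths: decay with respect to some length
    (∀ (LG : G → ℝ) (LH : H → ℝ), IsLengthFunction LG → IsLengthFunction LH →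
      (∀ a, LG (i a) = LH (j a)) →
      (HasRD LG → HasRD LH →
        ∃ L : Amalgam i j → ℝ, IsLengthFunction L ∧ HasRD L) ∧
      (HasSD LG → HasSD LH →
        ∃ L : Amalgam i j → ℝ, IsLengthFunction L ∧ HasSD L)) := by
  refine ⟨fun LG LH hG hH hA hG0 hH0 => ⟨amalgamLength_isLengthFunction hG hH hA,
    HasRD.amalgam hi hj hG hH hA hG0 hH0, HasSD.amalgam hi hj hG hH hA hG0 hH0,
    fun f => HasDecay.amalgam hi hj hG hH hA hG0 hH0⟩, fun LG LH hG hH hA => ?_⟩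
  have hG' := integralLength_isLengthFunction i.range hG
  have hH' := integralLength_isLengthFunction j.range hH
  have hA' : ∀ a, integralLength i.range LG (i a) = integralLength j.range LH (j a) := by
    intro a
    rw [integralLength_of_mem i.range ⟨a, rfl⟩, integralLength_of_mem j.range ⟨a, rfl⟩, hA]
  have hL := amalgamLength_isLengthFunction hG' hH' hA'
  exact ⟨fun hrG hrH => ⟨_, hL, HasRD.amalgam hi hj hG' hH' hA'
      (fun _ => integralLength_ne_zero _) (fun _ => integralLength_ne_zero _)
      (hrG.integralLength _) (hrH.integralLength _)⟩,
    fun hsG hsH => ⟨_, hL, HasSD.amalgam hi hj hG' hH' hA'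
      (fun _ => integralLength_ne_zero _) (fun _ => integralLength_ne_zero _)
      (hsG.integralLength _) (hsH.integralLength _)⟩⟩
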